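/- Let $M$ be a smooth (Hausdorff, second countable, boundaryless) manifold of dimension $n\ge 2$ with a smooth Riemannian metric $g$, let $\varepsilon>0$, and let $\alpha(\rho)$, $|\rho|<\varepsilon$, be a smooth one-parameter family of $g$-self-adjoint $(1,1)$-tensor fields on $M$ (that is, $\alpha(\rho)_x$ is jointly smooth in $(\rho,x)$) such that $\alpha(0)=\mathrm{Id}$ and $g(\alpha(\rho)\,\cdot,\cdot)$ is positive definite on $M$ for every $|\rho|<\varepsilon$. Let $\dot\alpha(0)$ denote the derivative of $\alpha$ with respect to $\rho$ at $\rho=0$. Put $B=\mathbb R^{+}\times(-\varepsilon,\varepsilon)$ with coordinates $(t,\rho)$, and endow $\widetilde M=B\times M$ with the Lorentzian metric $$\widetilde g=d(\rho t)\otimes dt+dt\otimes d(\rho t)+t^{2}\,g(\alpha(\rho)\,\cdot,\cdot).$$ Let $u\in C^\infty(M)$, let $\nabla u$ be the gradient of $u$ with respect to $g$ and $\|\nabla u\|^2=g(\nabla u,\nabla u)$, let $\nabla$ and $\widetilde\nabla$ be the Levi-Civita connections of $g$ and $\widetilde g$, and consider $$\Psi^{u}\colon M\to\widetilde M,\qquad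 \Psi^u(x)=(e^{u(x)},0,x),$$ and the following vector fields along $\Psi^u$: $$\xi^u=e^{u}\,\partial_t,\qquad \eta^u=\tfrac12 e^{-u}\|\nabla u\|^{2}\,\partial_t-e^{-2u}\,\partial_\rho+e^{-2u}\,\nabla u .$$ Then $(\Psi^u)^*\widetilde g=e^{2u}g$, and $\xi^u,\eta^u$ are smooth normal vector fields along $\Psi^u$ with $\widetilde g(\xi^u,\xi^u)=\widetilde g(\eta^u,\eta^u)=0$ and $\widetilde g(\xi^u,\eta^u)=-1$ (a global lightlike normal frame). Their Weingarten endomorphisms, defined by $\widetilde\nabla_V\zeta=-T\Psi^u(A_\zeta V)+\nabla^\perp_V\zeta$ with $\nabla^\perp_V\zeta$ normal, where $\widetilde\nabla$ also denotes the induced connection along $\Psi^u$, are $$A_{\xi^u}=-\mathrm{Id},\qquad A_{\eta^u}(V)=e^{-2u}\Big[\tfrac12\big(\dot\alpha(0)(V)-\|\nabla u\|^{2}V\big)+g(\nabla u,V)\,\nabla u-\nabla_V\nabla u\Big]$$ for every tangent vector $V$ of $M$. -/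

import Mathlib

open scoped Manifold ContDiff Topology
open Bundle

noncomputable section

namespace AmbientWeingarten

/-- The bilinear form `(v, w) ↦ B (L v) (L w)`. -/
def pullbackForm {F F' : Type*} [NormedAddCommGroup F] [NormedSpace ℝ F]
    [NormedAddCommGroup F'] [NormedSpace ℝ F'] (B : F →L[ℝ] F →L[ℝ] ℝ) (L : F' →L[ℝ] F) :
    F' →L[ℝ] F' →L[ℝ] ℝ :=
  B.bilinearComp L L

/-- The first-kind Christoffel symbols at `y` of a metric `B` on an open set of a vector space:
the linear form `u ↦ (∂_v B(w, u) + ∂_w B(v, u) - ∂_u B(v, w)) / 2`. -/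
def christoffelFirst {F : Type*} [NormedAddCommGroup F] [NormedSpace ℝ F]
    (B : F → F →L[ℝ] F →L[ℝ] ℝ) (y v w : F) : F →L[ℝ] ℝ :=
  (1 / 2 : ℝ) • (fderiv ℝ B y v w + fderiv ℝ B y w v - ((fderiv ℝ B y).flip v).flip w)

section Connection

variable {E : Type*} [NormedAddCommGroup E] [NormedSpace ℝ E]
  {H : Type*} [TopologicalSpace H] {I : ModelWithCorners ℝ E H}
  {M : Type*} [TopologicalSpace M] [ChartedSpace H M]
  {E' : Type*} [NormedAddCommGroup E'] [NormedSpace ℝ E']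
  {H' : Type*} [TopologicalSpace H'] {J : ModelWithCorners ℝ E' H'}
  {N : Type*} [TopologicalSpace N] [ChartedSpace H' N]

/-- The metric `G`, read in the preferred chart `φ` at `p`: the bilinear form
`G (φ⁻¹ y) (D φ⁻¹ v, D φ⁻¹ w)` in `v, w`, as a function of the coordinate `y`. (All manifolds here
are boundaryless and finite-dimensional, so charts have open image.) -/
def coordMetric (G : ∀ x : M, TangentSpace I x →L[ℝ] TangentSpace I x →L[ℝ] ℝ) (p : M) (y : E) :
    E →L[ℝ] E →L[ℝ] ℝ :=
  pullbackForm (F := E) (F' := E) (G ((extChartAt I p).symm y))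
    (mfderiv 𝓘(ℝ, E) I (extChartAt I p).symm y)

/-- The Christoffel symbols `Γ(v, w)` of `G` at `p` in the preferred chart at `p`: the first-kind
symbols with the index raised by `G`, so that
`2 G(Γ(v, w), u) = ∂_v G(w, u) + ∂_w G(v, u) - ∂_u G(v, w)`. (`ContinuousLinearMap.inverse` is
the inverse of the isomorphism `z ↦ G(z, ·)` when `G` is nondegenerate at `p`.) -/
def christoffel (G : ∀ x : M, TangentSpace I x →L[ℝ] TangentSpace I x →L[ℝ] ℝ) (p : M)
    (v w : E) : E :=
  (coordMetric G p (extChartAt I p p)).inverse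
    (christoffelFirst (coordMetric G p) (extChartAt I p p) v w)

/-- The covariant derivative `∇_v ξ` at `x` of a vector field `ξ` along a map `Ψ : N → M`, for the
connection induced by the Levi-Civita connection of the (semi-Riemannian) metric `G` on `M`.
In coordinates, `(∇_v ξ)^k = v(ξ^k) + Γ^k_{ij} (TΨ v)^i ξ^j`, where the chart used is the preferred
chart at `Ψ x`; this is the chart through which the fibre `TangentSpace I (Ψ x)` is identified
with the model space `E`. -/
def covDerivAlong (G : ∀ x : M, TangentSpace I x →L[ℝ] TangentSpace I x →L[ℝ] ℝ)
    (Ψ : N → M) (ξ : ∀ x : N, TangentSpace I (Ψ x)) (x : N) (v : TangentSpace J x) :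
    TangentSpace I (Ψ x) :=
  let ξcoord : N → E := fun x' => mfderiv I 𝓘(ℝ, E) (extChartAt I (Ψ x)) (Ψ x') (ξ x')
  let dξ : E := mfderiv J 𝓘(ℝ, E) ξcoord x v
  let dΨ : E := mfderiv J I Ψ x v
  (dξ + christoffel G (Ψ x) dΨ (ξ x) : E)

/-- The Levi-Civita covariant derivative `∇_v W` at `x` of a vector field `W`. -/
def leviCivita (G : ∀ x : M, TangentSpace I x →L[ℝ] TangentSpace I x →L[ℝ] ℝ)
    (W : ∀ x : M, TangentSpace I x) (x : M) (v : TangentSpace I x) : TangentSpace I x :=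
  covDerivAlong (J := I) G (fun y : M => y) W x v

/-- The gradient of `u`: the vector field with `G(grad u, ·) = du`. -/
def grad (G : ∀ x : M, TangentSpace I x →L[ℝ] TangentSpace I x →L[ℝ] ℝ) (u : M → ℝ) (x : M) :
    TangentSpace I x :=
  (G x).inverse (mvfderiv I u x)

/-- The tensor `Ψ^* G` induced on `N` by a map `Ψ : N → M`. -/
def inducedMetric (G : ∀ x : M, TangentSpace I x →L[ℝ] TangentSpace I x →L[ℝ] ℝ) (Ψ : N → M)
    (x : N) : TangentSpace J x →L[ℝ] TangentSpace J x →L[ℝ] ℝ :=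
  pullbackForm (F := E) (F' := E') (G (Ψ x)) (mfderiv J I Ψ x)

/-- The tangent part of `z ∈ T_{Ψ x} M` for an immersion `Ψ` with nondegenerate induced metric,
as a vector of `T_x N`: the vector `v` with `G(TΨ v, TΨ w) = G(z, TΨ w)` for all `w`, that is,
such that `z - TΨ v` is orthogonal to the image of `TΨ`. -/
def tangentPart (G : ∀ x : M, TangentSpace I x →L[ℝ] TangentSpace I x →L[ℝ] ℝ) (Ψ : N → M)
    (x : N) (z : TangentSpace I (Ψ x)) : TangentSpace J x :=
  (inducedMetric (J := J) G Ψ x).inverse ((G (Ψ x) z).comp (mfderiv J I Ψ x))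

/-- The Weingarten endomorphism `A_ξ` of a normal field `ξ` along `Ψ`, defined by the Weingarten
formula `∇_v ξ = - TΨ (A_ξ v) + ∇^⊥_v ξ`. -/
def weingarten (G : ∀ x : M, TangentSpace I x →L[ℝ] TangentSpace I x →L[ℝ] ℝ) (Ψ : N → M)
    (ξ : ∀ x : N, TangentSpace I (Ψ x)) (x : N) (v : TangentSpace J x) : TangentSpace J x :=
  - tangentPart (J := J) G Ψ x (covDerivAlong (J := J) G Ψ ξ x v)

variable (J) in
/-- `ξ, η` is a global lightlike normal frame along the codimension two immersion `Ψ`: smooth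
normal fields along `Ψ` with `G(ξ, ξ) = G(η, η) = 0` and `G(ξ, η) = -1`. -/
structure IsLightlikeNormalFrame
    (G : ∀ x : M, TangentSpace I x →L[ℝ] TangentSpace I x →L[ℝ] ℝ)
    (Ψ : N → M) (ξ η : ∀ x : N, TangentSpace I (Ψ x)) [IsManifold I 1 M] : Prop where
  smooth_left : ContMDiff J I.tangent ∞ (fun x => (⟨Ψ x, ξ x⟩ : TangentBundle I M))
  smooth_right : ContMDiff J I.tangent ∞ (fun x => (⟨Ψ x, η x⟩ : TangentBundle I M))
  normal_left : ∀ (x : N) (v : TangentSpace J x), G (Ψ x) (ξ x) (mfderiv J I Ψ x v) = 0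
  normal_right : ∀ (x : N) (v : TangentSpace J x), G (Ψ x) (η x) (mfderiv J I Ψ x v) = 0
  null_left : ∀ x, G (Ψ x) (ξ x) (ξ x) = 0
  null_right : ∀ x, G (Ψ x) (η x) (η x) = 0
  pairing : ∀ x, G (Ψ x) (ξ x) (η x) = -1

end Connection

section Ambient

/-- The open set `B = ℝ⁺ × (-ε, ε)` of the plane, with coordinates `(t, ρ)`. -/
def ambientBase (ε : ℝ) : TopologicalSpace.Opens (ℝ × ℝ) where
  carrier := Set.Ioi 0 ×ˢ Set.Ioo (-ε) ε
  is_open' := isOpen_Ioi.prod isOpen_Ioo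

variable {n : ℕ} {M : Type*} [TopologicalSpace M] [ChartedSpace (EuclideanSpace ℝ (Fin n)) M]

/-- The model of the ambient manifold `B × M`. -/
abbrev ambientModel (n : ℕ) :
    ModelWithCorners ℝ ((ℝ × ℝ) × EuclideanSpace ℝ (Fin n))
      (ModelProd (ℝ × ℝ) (EuclideanSpace ℝ (Fin n))) :=
  𝓘(ℝ, ℝ × ℝ).prod (𝓡 n)

variable {ε : ℝ}

/-- The tangent vector `a ∂_t + b ∂_ρ + v` of `B × M` at `p`, with `v` tangent to `M`. -/
def ambientVec (p : ambientBase ε × M) (a b : ℝ) (v : TangentSpace (𝓡 n) p.2) :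
    TangentSpace (ambientModel n) p :=
  (((a, b), v) : (ℝ × ℝ) × EuclideanSpace ℝ (Fin n))

/-- The one-form `dt` on `B × M`. -/
def formDt (p : ambientBase ε × M) : TangentSpace (ambientModel n) p →L[ℝ] ℝ :=
  (ContinuousLinearMap.fst ℝ ℝ ℝ).comp
    (ContinuousLinearMap.fst ℝ (ℝ × ℝ) (EuclideanSpace ℝ (Fin n)))

/-- The one-form `dρ` on `B × M`. -/
def formDrho (p : ambientBase ε × M) : TangentSpace (ambientModel n) p →L[ℝ] ℝ :=
  (ContinuousLinearMap.snd ℝ ℝ ℝ).comp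
    (ContinuousLinearMap.fst ℝ (ℝ × ℝ) (EuclideanSpace ℝ (Fin n)))

/-- The differential of the projection `B × M → M`. -/
def projM (p : ambientBase ε × M) : TangentSpace (ambientModel n) p →L[ℝ] TangentSpace (𝓡 n) p.2 :=
  ContinuousLinearMap.snd ℝ (ℝ × ℝ) (EuclideanSpace ℝ (Fin n))

/-- The one-form `d(ρ t) = ρ dt + t dρ` on `B × M`. -/
def formDrhot (p : ambientBase ε × M) : TangentSpace (ambientModel n) p →L[ℝ] ℝ :=
  p.1.1.2 • formDt p + p.1.1.1 • formDrho p

/-- The form `⟨·, ·⟩_ρ = g(α(ρ) ·, ·)` of the slice through `p = (t, ρ, x)`, pulled back to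
`B × M`. -/
def deformedForm (g : ∀ x : M, TangentSpace (𝓡 n) x →L[ℝ] TangentSpace (𝓡 n) x →L[ℝ] ℝ)
    (α : ℝ → ∀ x : M, TangentSpace (𝓡 n) x →L[ℝ] TangentSpace (𝓡 n) x)
    (p : ambientBase ε × M) :
    TangentSpace (ambientModel n) p →L[ℝ] TangentSpace (ambientModel n) p →L[ℝ] ℝ :=
  pullbackForm (F := EuclideanSpace ℝ (Fin n)) (F' := (ℝ × ℝ) × EuclideanSpace ℝ (Fin n))
    ((g p.2).comp (α p.1.1.2 p.2)) (projM p)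

/-- The ambient metric `d(ρ t) ⊗ dt + dt ⊗ d(ρ t) + t² g(α(ρ) ·, ·)` on `B × M`. -/
def ambientMetric (g : ∀ x : M, TangentSpace (𝓡 n) x →L[ℝ] TangentSpace (𝓡 n) x →L[ℝ] ℝ)
    (α : ℝ → ∀ x : M, TangentSpace (𝓡 n) x →L[ℝ] TangentSpace (𝓡 n) x)
    (p : ambientBase ε × M) :
    TangentSpace (ambientModel n) p →L[ℝ] TangentSpace (ambientModel n) p →L[ℝ] ℝ :=
  (formDrhot p).smulRight (formDt p) + (formDt p).smulRight (formDrhot p)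
    + p.1.1.1 ^ 2 • deformedForm g α p

/-- The map `Ψ^u : M → B × M`, `x ↦ (e^{u(x)}, 0, x)`. -/
def scaleImmersion (hε : 0 < ε) (u : M → ℝ) (x : M) : ambientBase ε × M :=
  (⟨(Real.exp (u x), 0), Real.exp_pos _, neg_lt_zero.mpr hε, hε⟩, x)

/-- The normal field `ξ^u = e^u ∂_t` along `Ψ^u`. -/
def xiField (hε : 0 < ε) (u : M → ℝ) (x : M) :
    TangentSpace (ambientModel n) (scaleImmersion hε u x) :=
  ambientVec (scaleImmersion hε u x) (Real.exp (u x)) 0 0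

/-- The normal field `η^u = (e^{-u} |∇u|² / 2) ∂_t - e^{-2u} ∂_ρ + e^{-2u} ∇u` along `Ψ^u`. -/
def etaField (g : ∀ x : M, TangentSpace (𝓡 n) x →L[ℝ] TangentSpace (𝓡 n) x →L[ℝ] ℝ)
    (hε : 0 < ε) (u : M → ℝ) (x : M) :
    TangentSpace (ambientModel n) (scaleImmersion hε u x) :=
  ambientVec (scaleImmersion hε u x)
    (Real.exp (-u x) * (g x (grad g u x) (grad g u x) / 2))
    (-Real.exp (-2 * u x))
    (Real.exp (-2 * u x) • grad g u x)

/-- The derivative `α̇(0)(v)` of the curve `ρ ↦ α(ρ)(v)` in `T_x M` at `ρ = 0`. -/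
def alphaDot (α : ℝ → ∀ x : M, TangentSpace (𝓡 n) x →L[ℝ] TangentSpace (𝓡 n) x)
    (x : M) (v : TangentSpace (𝓡 n) x) : TangentSpace (𝓡 n) x :=
  deriv (F := TangentSpace (𝓡 n) x) (fun ρ : ℝ => α ρ x v) 0

/-- A smooth one-parameter family `α(ρ)`, `|ρ| < ε`, of `g`-self-adjoint endomorphism fields with
`α(0) = Id` such that `g(α(ρ) ·, ·)` is positive definite for `|ρ| < ε`. Values of `α` outside
`(-ε, ε)` are irrelevant. -/
structure IsAdmissibleFamily [IsManifold (𝓡 n) ∞ M] (ε : ℝ)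
    (g : ∀ x : M, TangentSpace (𝓡 n) x →L[ℝ] TangentSpace (𝓡 n) x →L[ℝ] ℝ)
    (α : ℝ → ∀ x : M, TangentSpace (𝓡 n) x →L[ℝ] TangentSpace (𝓡 n) x) : Prop where
  smooth : ContMDiffOn (𝓘(ℝ, ℝ).prod (𝓡 n))
    ((𝓡 n).prod 𝓘(ℝ, EuclideanSpace ℝ (Fin n) →L[ℝ] EuclideanSpace ℝ (Fin n))) ∞
    (fun q : ℝ × M => TotalSpace.mk' (EuclideanSpace ℝ (Fin n) →L[ℝ] EuclideanSpace ℝ (Fin n))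
      (E := fun x : M => TangentSpace (𝓡 n) x →L[ℝ] TangentSpace (𝓡 n) x) q.2 (α q.1 q.2))
    (Set.Ioo (-ε) ε ×ˢ Set.univ)
  selfAdjoint : ∀ ρ ∈ Set.Ioo (-ε) ε, ∀ (x : M) (v w : TangentSpace (𝓡 n) x),
    g x (α ρ x v) w = g x v (α ρ x w)
  at_zero : ∀ x : M, α 0 x = ContinuousLinearMap.id ℝ (TangentSpace (𝓡 n) x)
  posDef : ∀ ρ ∈ Set.Ioo (-ε) ε, ∀ (x : M) (v : TangentSpace (𝓡 n) x), v ≠ 0 → 0 < g x (α ρ x v) v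

end Ambient

end AmbientWeingarten

end

/-! The induced metric is `e^{2u} g`, hence nondegenerate, so `A_ζ v` is determined by the products
of the covariant derivative of `ζ` along `v` with the vectors `TΨ w = e^u du(w) ∂_t + w`. By
Koszul's formula these products involve only first-kind Christoffel symbols. The ambient metric must
be known to be invertible, but its inverse is never computed.

The chart of `B × M` is the identity on `B` times a chart of `M`. At `ρ = 0`, differentiating the
metric along `a ∂_t + b ∂_ρ + d` yields the terms from the `B` block, then `2ta g`, then `t² (b
g(α̇(0)·,·) + ∂_d g)`; this is `fderiv_coordMetric_ambient`. Since `TΨ w` has no `∂_ρ` component,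
its product with a vector does not see the `∂_t` component of that vector
(`metric_mfderiv_scaleImmersion`). Hence the `∂_t` coefficient of `ζ` is never differentiated: its
value enters only through `∂_t (t² g)`. The value of the `∂_ρ` coefficient brings in `α̇(0)`,
through `∂_ρ (t² g(α(ρ)·,·))`. `metric_covDerivAlong_scaleImmersion` collects all contributions.

For `ξ` only the `∂_t (t² g)` term survives, and it equals the induced metric, whence `-Id`. For `η`
the Christoffel symbols of `g` complete the coordinate derivative of `∇u` to `∇_v ∇u`, the `∂_t`
coefficient gives the `‖∇u‖²` term, and the remaining multiples of `du(v) du(w)` add up to the term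
in `g(∇u, v) ∇u`. -/

noncomputable section

namespace AmbientWeingarten

/-! ### Bilinear forms in finite dimension, and families of them. -/

section BilinearForms

variable {F : Type*} [NormedAddCommGroup F] [NormedSpace ℝ F] [FiniteDimensional ℝ F]

/-- A nondegenerate bilinear form on a finite-dimensional space is an isomorphism onto the dual. -/
lemma isInvertible_of_nondegenerate (B : F →L[ℝ] F →L[ℝ] ℝ)
    (h : ∀ v, (∀ w, B v w = 0) → v = 0) : B.IsInvertible := by
  have hfin : Module.finrank ℝ F = Module.finrank ℝ (F →L[ℝ] ℝ) := by
    rw [← (LinearMap.toContinuousLinearMap (𝕜 := ℝ) (E := F) (F' := ℝ)).finrank_eq]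
    exact (Subspace.dual_finrank_eq (K := ℝ) (V := F)).symm
  have hinj : Function.Injective (B : F →ₗ[ℝ] F →L[ℝ] ℝ) := by
    refine (injective_iff_map_eq_zero _).2 fun v hv => h v fun w => ?_
    exact congrArg (fun f : F →L[ℝ] ℝ => f w) hv
  refine ⟨(LinearEquiv.ofInjectiveOfFinrankEq (B : F →ₗ[ℝ] F →L[ℝ] ℝ) hinj
    hfin).toContinuousLinearEquiv, ?_⟩
  ext v w
  rfl

variable {D : Type*} [NormedAddCommGroup D] [NormedSpace ℝ D]

/-- A basis of `F` identifies `F →L[ℝ] G` with a finite power of `G`, where smoothness is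
componentwise. -/
lemma contDiffAt_of_clm_apply {G : Type*} [NormedAddCommGroup G] [NormedSpace ℝ G]
    {k : WithTop ℕ∞} {f : D → F →L[ℝ] G} {x : D}
    (h : ∀ y, ContDiffAt ℝ k (fun x => f x y) x) : ContDiffAt ℝ k f x := by
  let d := Module.finrank ℝ F
  have hd : d = Module.finrank ℝ (Fin d → ℝ) := (Module.finrank_fin_fun ℝ).symm
  let e₁ := ContinuousLinearEquiv.ofFinrankEq hd
  let e₂ := (e₁.arrowCongr (1 : G ≃L[ℝ] G)).trans (ContinuousLinearEquiv.piRing (Fin d))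
  rw [← Function.id_comp f, ← e₂.symm_comp_self]
  exact e₂.symm.contDiff.contDiffAt.comp x (contDiffAt_pi.mpr fun i => h _)

/-- A family of bilinear forms is `C^k` if all its values are. -/
lemma contDiffAt_of_bilin_apply {k : WithTop ℕ∞} {B : D → F →L[ℝ] F →L[ℝ] ℝ} {x : D}
    (h : ∀ v w, ContDiffAt ℝ k (fun x => B x v w) x) : ContDiffAt ℝ k B x :=
  contDiffAt_of_clm_apply fun v => contDiffAt_of_clm_apply fun w => h v w

omit [FiniteDimensional ℝ F] in
lemma fderiv_bilin_apply {B : D → F →L[ℝ] F →L[ℝ] ℝ} {x : D} (hB : DifferentiableAt ℝ B x)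
    (d : D) (v w : F) : fderiv ℝ B x d v w = fderiv ℝ (fun x => B x v w) x d := by
  have h1 := (hB.hasFDerivAt.clm_apply (hasFDerivAt_const v x)).clm_apply (hasFDerivAt_const w x)
  rw [h1.fderiv]
  simp

omit [FiniteDimensional ℝ F] in
lemma christoffelFirst_apply (B : F → F →L[ℝ] F →L[ℝ] ℝ) (y v w u : F) :
    christoffelFirst B y v w u =
      (fderiv ℝ B y v w u + fderiv ℝ B y w v u - fderiv ℝ B y u v w) / 2 := by
  simp only [christoffelFirst, smul_apply, sub_apply,
    add_apply, ContinuousLinearMap.flip_apply, smul_eq_mul]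
  ring

end BilinearForms

/-! ### The ambient metric in components. -/

section Ambient

variable {n : ℕ} {M : Type*} [TopologicalSpace M] [ChartedSpace (EuclideanSpace ℝ (Fin n)) M]
  {ε : ℝ}

lemma ambientMetric_apply
    (g : ∀ x : M, TangentSpace (𝓡 n) x →L[ℝ] TangentSpace (𝓡 n) x →L[ℝ] ℝ)
    (α : ℝ → ∀ x : M, TangentSpace (𝓡 n) x →L[ℝ] TangentSpace (𝓡 n) x)
    (p : ambientBase ε × M) (X Y : (ℝ × ℝ) × EuclideanSpace ℝ (Fin n)) :
    ambientMetric g α p X Y =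
      (p.1.1.2 * X.1.1 + p.1.1.1 * X.1.2) * Y.1.1 + X.1.1 * (p.1.1.2 * Y.1.1 + p.1.1.1 * Y.1.2)
        + p.1.1.1 ^ 2 * g p.2 (α p.1.1.2 p.2 X.2) Y.2 := rfl

end Ambient

/-! ### Metric, Christoffel symbols and fields in the preferred chart. -/

section Manifold

variable {E : Type*} [NormedAddCommGroup E] [NormedSpace ℝ E]
  {H : Type*} [TopologicalSpace H] {I : ModelWithCorners ℝ E H}
  {M : Type*} [TopologicalSpace M] [ChartedSpace H M]
  {E' : Type*} [NormedAddCommGroup E'] [NormedSpace ℝ E']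
  {H' : Type*} [TopologicalSpace H'] {J : ModelWithCorners ℝ E' H'}
  {N : Type*} [TopologicalSpace N] [ChartedSpace H' N]

/-- The tangent space at `x` is identified with `E` through the preferred chart at `x` itself, so at
its centre the chart has identity derivative. -/
lemma mfderiv_extChartAt_symm_self [I.Boundaryless] [IsManifold I 1 M] (x : M) :
    mfderiv 𝓘(ℝ, E) I (extChartAt I x).symm (extChartAt I x x) = ContinuousLinearMap.id ℝ E := by
  have := mfderivWithin_range_extChartAt_symm (I := I) (x := x)
  rwa [I.range_eq_univ, mfderivWithin_univ] at this

/-- The form `G x` as a bilinear form on the model space. -/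
def modelForm (G : ∀ x : M, TangentSpace I x →L[ℝ] TangentSpace I x →L[ℝ] ℝ) (x : M) :
    E →L[ℝ] E →L[ℝ] ℝ := G x

lemma coordMetric_apply (G : ∀ x : M, TangentSpace I x →L[ℝ] TangentSpace I x →L[ℝ] ℝ) (p : M)
    (y v w : E) :
    coordMetric G p y v w = modelForm G ((extChartAt I p).symm y)
      (mfderiv 𝓘(ℝ, E) I (extChartAt I p).symm y v)
      (mfderiv 𝓘(ℝ, E) I (extChartAt I p).symm y w) := rfl

lemma coordMetric_self [I.Boundaryless] [IsManifold I 1 M]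
    (G : ∀ x : M, TangentSpace I x →L[ℝ] TangentSpace I x →L[ℝ] ℝ) (p : M) :
    coordMetric G p (extChartAt I p p) = modelForm G p := by
  ext v w
  rw [coordMetric_apply, mfderiv_extChartAt_symm_self, extChartAt_to_inv]
  rfl

/-- The characteristic property of the Christoffel symbols. -/
lemma metric_christoffel [I.Boundaryless] [IsManifold I 1 M]
    (G : ∀ x : M, TangentSpace I x →L[ℝ] TangentSpace I x →L[ℝ] ℝ) (p : M)
    (hG : (modelForm G p).IsInvertible) (v w u : E) :
    modelForm G p (christoffel G p v w) u =
      christoffelFirst (coordMetric G p) (extChartAt I p p) v w u := by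
  unfold christoffel
  rw [coordMetric_self, hG.self_apply_inverse]

/-- A smooth field along a map has smooth coordinates in the preferred chart. -/
lemma contMDiffAt_fieldCoord [IsManifold I 1 M] {Ψ : N → M}
    {ξ : ∀ x : N, TangentSpace I (Ψ x)} {k : WithTop ℕ∞} {x : N}
    (h : ContMDiffAt J I.tangent k (fun x => (⟨Ψ x, ξ x⟩ : TangentBundle I M)) x) :
    ContMDiffAt J 𝓘(ℝ, E) k
      (fun x' => (mfderiv I 𝓘(ℝ, E) (extChartAt I (Ψ x)) (Ψ x') (ξ x') : E)) x := by
  have h2 := contMDiffAt_totalSpace.1 h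
  refine h2.2.congr_of_eventuallyEq ?_
  -- The fibre map of the trivialization is the derivative of the chart only over the chart source,
  -- so the two readings of `ξ` agree near `x` and not everywhere.
  have hs : ∀ᶠ x' in 𝓝 x, Ψ x' ∈ (chartAt H (Ψ x)).source :=
    h2.1.continuousAt.preimage_mem_nhds
      ((chartAt H (Ψ x)).open_source.mem_nhds (mem_chart_source H (Ψ x)))
  filter_upwards [hs] with x' hx'
  have := TangentBundle.continuousLinearMapAt_trivializationAt (𝕜 := ℝ) (I := I) hx'
  rw [← this]
  exact congrFun (Trivialization.coe_linearMapAt_of_mem (R := ℝ)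
    (trivializationAt E (TangentSpace I) (Ψ x)) hx') (ξ x')

end Manifold

/-! ### Charts of the product `B × M` and derivatives by components. -/

section AmbientCharts

variable {n : ℕ} {M : Type*} [TopologicalSpace M] [ChartedSpace (EuclideanSpace ℝ (Fin n)) M]
  {ε : ℝ}
  {E' : Type*} [NormedAddCommGroup E'] [NormedSpace ℝ E']
  {H' : Type*} [TopologicalSpace H'] {J : ModelWithCorners ℝ E' H'}
  {N : Type*} [TopologicalSpace N] [ChartedSpace H' N]

lemma extChartAt_ambientBase (b : ambientBase ε) :
    (extChartAt 𝓘(ℝ, ℝ × ℝ) b : ambientBase ε → ℝ × ℝ) = Subtype.val := rfl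

lemma mfderiv_ambientBase_val (b : ambientBase ε) :
    mfderiv 𝓘(ℝ, ℝ × ℝ) 𝓘(ℝ, ℝ × ℝ) (Subtype.val : ambientBase ε → ℝ × ℝ) b
      = ContinuousLinearMap.id ℝ (ℝ × ℝ) := by
  rw [← extChartAt_ambientBase b]
  exact mfderiv_extChartAt_self

lemma mdifferentiableAt_ambientBase_val (b : ambientBase ε) :
    MDifferentiableAt 𝓘(ℝ, ℝ × ℝ) 𝓘(ℝ, ℝ × ℝ) (Subtype.val : ambientBase ε → ℝ × ℝ) b :=
  (contMDiff_subtype_val (n := 1) b).mdifferentiableAt one_ne_zero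

/-- The inclusion of `B` in the plane has identity derivative, so the `B` component may be
differentiated as a plane-valued map. -/
lemma mfderiv_ambient_fst {f : N → ambientBase ε × M} {x : N}
    (hf : MDifferentiableAt J (ambientModel n) f x) (v : TangentSpace J x) :
    (show (ℝ × ℝ) × EuclideanSpace ℝ (Fin n) from mfderiv J (ambientModel n) f x v).1 =
      mfderiv J 𝓘(ℝ, ℝ × ℝ) (fun y => ((f y).1 : ℝ × ℝ)) x v := by
  have h1 := mfderiv_comp x (mdifferentiableAt_fst (I := 𝓘(ℝ, ℝ × ℝ)) (I' := 𝓡 n)) hf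
  have h2 := mfderiv_comp x (f := fun y => (f y).1) (mdifferentiableAt_ambientBase_val _)
    (mdifferentiableAt_fst (I := 𝓘(ℝ, ℝ × ℝ)) (I' := 𝓡 n) |>.comp x hf)
  have h3 : mfderiv J 𝓘(ℝ, ℝ × ℝ) (fun y => (f y).1) x = _ := h1
  rw [h3, mfderiv_ambientBase_val, mfderiv_fst] at h2
  exact (DFunLike.congr_fun h2 v).symm

lemma mfderiv_ambient_snd {f : N → ambientBase ε × M} {x : N}
    (hf : MDifferentiableAt J (ambientModel n) f x) (v : TangentSpace J x) :
    (show (ℝ × ℝ) × EuclideanSpace ℝ (Fin n) from mfderiv J (ambientModel n) f x v).2 =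
      mfderiv J (𝓡 n) (fun y => (f y).2) x v := by
  have h1 := mfderiv_comp x (mdifferentiableAt_snd (I := 𝓘(ℝ, ℝ × ℝ)) (I' := 𝓡 n)) hf
  rw [mfderiv_snd] at h1
  exact (DFunLike.congr_fun h1 v).symm

/-- The derivative of a map into a product of vector spaces, by components. -/
lemma mfderiv_prod_fst {F G : Type*} [NormedAddCommGroup F] [NormedSpace ℝ F]
    [NormedAddCommGroup G] [NormedSpace ℝ G] {f : N → F × G} {x : N}
    (hf : MDifferentiableAt J 𝓘(ℝ, F × G) f x) (v : TangentSpace J x) :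
    (show F × G from mfderiv J 𝓘(ℝ, F × G) f x v).1 =
      mfderiv J 𝓘(ℝ, F) (fun y => (f y).1) x v := by
  have h1 := mfderiv_comp x (ContinuousLinearMap.fst ℝ F G).mdifferentiableAt hf
  rw [ContinuousLinearMap.mfderiv_eq] at h1
  exact (DFunLike.congr_fun h1 v).symm

lemma mfderiv_prod_snd {F G : Type*} [NormedAddCommGroup F] [NormedSpace ℝ F]
    [NormedAddCommGroup G] [NormedSpace ℝ G] {f : N → F × G} {x : N}
    (hf : MDifferentiableAt J 𝓘(ℝ, F × G) f x) (v : TangentSpace J x) :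
    (show F × G from mfderiv J 𝓘(ℝ, F × G) f x v).2 =
      mfderiv J 𝓘(ℝ, G) (fun y => (f y).2) x v := by
  have h1 := mfderiv_comp x (ContinuousLinearMap.snd ℝ F G).mdifferentiableAt hf
  rw [ContinuousLinearMap.mfderiv_eq] at h1
  exact (DFunLike.congr_fun h1 v).symm

lemma extChartAt_ambient_apply (p q : ambientBase ε × M) :
    extChartAt (ambientModel n) p q = ((q.1 : ℝ × ℝ), extChartAt (𝓡 n) p.2 q.2) := rfl

lemma extChartAt_ambient_symm_fst (p : ambientBase ε × M)
    {y : (ℝ × ℝ) × EuclideanSpace ℝ (Fin n)} (hy : y ∈ (extChartAt (ambientModel n) p).target) :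
    (((extChartAt (ambientModel n) p).symm y).1 : ℝ × ℝ) = y.1 :=
  congrArg Prod.fst ((extChartAt (ambientModel n) p).right_inv hy)

variable [IsManifold (𝓡 n) ∞ M]

lemma mfderiv_extChartAt_ambient (p q : ambientBase ε × M)
    (hq : q ∈ (chartAt (ModelProd (ℝ × ℝ) (EuclideanSpace ℝ (Fin n))) p).source)
    (X : TangentSpace (ambientModel n) q) :
    (mfderiv (ambientModel n) 𝓘(ℝ, (ℝ × ℝ) × EuclideanSpace ℝ (Fin n))
      (extChartAt (ambientModel n) p) q X : (ℝ × ℝ) × EuclideanSpace ℝ (Fin n)) =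
      ((show (ℝ × ℝ) × EuclideanSpace ℝ (Fin n) from X).1,
        mfderiv (𝓡 n) 𝓘(ℝ, EuclideanSpace ℝ (Fin n)) (extChartAt (𝓡 n) p.2) q.2
          (show (ℝ × ℝ) × EuclideanSpace ℝ (Fin n) from X).2) := by
  have hd : MDifferentiableAt (ambientModel n) 𝓘(ℝ, (ℝ × ℝ) × EuclideanSpace ℝ (Fin n))
    (extChartAt (ambientModel n) p) q := mdifferentiableAt_extChartAt hq
  have hq2 : q.2 ∈ (chartAt (EuclideanSpace ℝ (Fin n)) p.2).source := hq.2
  refine Prod.ext ((mfderiv_prod_fst hd X).trans ?_) ((mfderiv_prod_snd hd X).trans ?_)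
  · have h1 := mfderiv_comp (I := ambientModel n) q (mdifferentiableAt_ambientBase_val q.1)
      (mdifferentiableAt_fst (I := 𝓘(ℝ, ℝ × ℝ)) (I' := 𝓡 n))
    rw [mfderiv_ambientBase_val, mfderiv_fst] at h1
    exact DFunLike.congr_fun h1 X
  · have h1 := mfderiv_comp (I := ambientModel n) q
      (mdifferentiableAt_extChartAt (I := 𝓡 n) hq2)
      (mdifferentiableAt_snd (I := 𝓘(ℝ, ℝ × ℝ)) (I' := 𝓡 n))
    rw [mfderiv_snd] at h1
    exact DFunLike.congr_fun h1 X

lemma mdifferentiableAt_extChartAt_symm {E : Type*} [NormedAddCommGroup E] [NormedSpace ℝ E]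
    {H : Type*} [TopologicalSpace H] {I : ModelWithCorners ℝ E H} [I.Boundaryless]
    {M : Type*} [TopologicalSpace M] [ChartedSpace H M] [IsManifold I 1 M] {x : M} {y : E}
    (hy : y ∈ (extChartAt I x).target) :
    MDifferentiableAt 𝓘(ℝ, E) I (extChartAt I x).symm y := by
  have := mdifferentiableWithinAt_extChartAt_symm (I := I) hy
  rwa [I.range_eq_univ, mdifferentiableWithinAt_univ] at this

lemma mfderiv_extChartAt_symm_ambient (p : ambientBase ε × M)
    {y : (ℝ × ℝ) × EuclideanSpace ℝ (Fin n)}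
    (hy : y ∈ (extChartAt (ambientModel n) p).target)
    (X : (ℝ × ℝ) × EuclideanSpace ℝ (Fin n)) :
    (mfderiv 𝓘(ℝ, (ℝ × ℝ) × EuclideanSpace ℝ (Fin n)) (ambientModel n)
      (extChartAt (ambientModel n) p).symm y X : (ℝ × ℝ) × EuclideanSpace ℝ (Fin n)) =
      (X.1, mfderiv 𝓘(ℝ, EuclideanSpace ℝ (Fin n)) (𝓡 n) (extChartAt (𝓡 n) p.2).symm y.2 X.2) := by
  have hd := mdifferentiableAt_extChartAt_symm (I := ambientModel n) hy
  have hy2 : y.2 ∈ (extChartAt (𝓡 n) p.2).target := by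
    rw [extChartAt_prod] at hy
    exact hy.2
  refine Prod.ext ((mfderiv_ambient_fst hd X).trans ?_) ((mfderiv_ambient_snd hd X).trans ?_)
  · have he : (fun y => (((extChartAt (ambientModel n) p).symm y).1 : ℝ × ℝ)) =ᶠ[𝓝 y]
        (ContinuousLinearMap.fst ℝ (ℝ × ℝ) (EuclideanSpace ℝ (Fin n))) := by
      filter_upwards [(isOpen_extChartAt_target (I := ambientModel n) p).mem_nhds hy] with z hz
      exact extChartAt_ambient_symm_fst p hz
    rw [he.mfderiv_eq, ContinuousLinearMap.mfderiv_eq]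
    rfl
  · have h1 := mfderiv_comp y (g := (extChartAt (𝓡 n) p.2).symm)
      (mdifferentiableAt_extChartAt_symm (I := 𝓡 n) hy2)
      (ContinuousLinearMap.snd ℝ (ℝ × ℝ) (EuclideanSpace ℝ (Fin n))).mdifferentiableAt
    have h2 := (ContinuousLinearMap.snd ℝ (ℝ × ℝ) (EuclideanSpace ℝ (Fin n))).mfderiv_eq (x := y)
    exact (DFunLike.congr_fun h1 X).trans
      (congrArg (mfderiv 𝓘(ℝ, EuclideanSpace ℝ (Fin n)) (𝓡 n) (extChartAt (𝓡 n) p.2).symm y.2)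
        (DFunLike.congr_fun h2 X))

end AmbientCharts

/-! ### Smoothness of the metric coefficients, without which the derivatives in the Christoffel
symbols could be the default value zero. -/

section Smoothness

variable {n : ℕ} {M : Type*} [TopologicalSpace M] [ChartedSpace (EuclideanSpace ℝ (Fin n)) M]
  {ε : ℝ}

/-- The forms `g(α(ρ) ·, ·)` read in the preferred chart at `x`, as a function of `ρ` and the
coordinate. -/
def slabForm (g : ∀ x : M, TangentSpace (𝓡 n) x →L[ℝ] TangentSpace (𝓡 n) x →L[ℝ] ℝ)
    (α : ℝ → ∀ x : M, TangentSpace (𝓡 n) x →L[ℝ] TangentSpace (𝓡 n) x) (x : M)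
    (q : ℝ × EuclideanSpace ℝ (Fin n)) :
    EuclideanSpace ℝ (Fin n) →L[ℝ] EuclideanSpace ℝ (Fin n) →L[ℝ] ℝ :=
  coordMetric (fun y => (g y).comp (α q.1 y)) x q.2

lemma slabForm_apply (g : ∀ x : M, TangentSpace (𝓡 n) x →L[ℝ] TangentSpace (𝓡 n) x →L[ℝ] ℝ)
    (α : ℝ → ∀ x : M, TangentSpace (𝓡 n) x →L[ℝ] TangentSpace (𝓡 n) x) (x : M)
    (q : ℝ × EuclideanSpace ℝ (Fin n)) (v w : EuclideanSpace ℝ (Fin n)) :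
    slabForm g α x q v w =
      g ((extChartAt (𝓡 n) x).symm q.2) (α q.1 ((extChartAt (𝓡 n) x).symm q.2)
        (mfderiv 𝓘(ℝ, EuclideanSpace ℝ (Fin n)) (𝓡 n) (extChartAt (𝓡 n) x).symm q.2 v))
        (mfderiv 𝓘(ℝ, EuclideanSpace ℝ (Fin n)) (𝓡 n) (extChartAt (𝓡 n) x).symm q.2 w) := rfl

lemma slabForm_zero [IsManifold (𝓡 n) ∞ M]
    (g : ∀ x : M, TangentSpace (𝓡 n) x →L[ℝ] TangentSpace (𝓡 n) x →L[ℝ] ℝ)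
    {α : ℝ → ∀ x : M, TangentSpace (𝓡 n) x →L[ℝ] TangentSpace (𝓡 n) x}
    (hα : IsAdmissibleFamily ε g α) (x : M) (y : EuclideanSpace ℝ (Fin n)) :
    slabForm g α x (0, y) = coordMetric g x y := by
  have : (fun y => (g y).comp (α 0 y)) = g := by
    funext z
    rw [hα.at_zero]
    rfl
  unfold slabForm
  rw [this]

lemma slabForm_base [IsManifold (𝓡 n) ∞ M]
    (g : ∀ x : M, TangentSpace (𝓡 n) x →L[ℝ] TangentSpace (𝓡 n) x →L[ℝ] ℝ)
    (α : ℝ → ∀ x : M, TangentSpace (𝓡 n) x →L[ℝ] TangentSpace (𝓡 n) x) (x : M) (ρ : ℝ)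
    (v : EuclideanSpace ℝ (Fin n)) :
    slabForm g α x (ρ, extChartAt (𝓡 n) x x) v = modelForm g x (α ρ x v) := by
  unfold slabForm
  rw [coordMetric_self]
  rfl

variable [IsManifold (𝓡 n) ∞ M]

/-- In the trivialization at `x` this field is constant near `x`. -/
lemma contMDiffAt_localFrame (x : M) (v : EuclideanSpace ℝ (Fin n)) :
    ContMDiffAt (𝓡 n) ((𝓡 n).prod 𝓘(ℝ, EuclideanSpace ℝ (Fin n))) ∞
      (fun y => TotalSpace.mk' (EuclideanSpace ℝ (Fin n)) (E := TangentSpace (𝓡 n) (M := M)) y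
        ((trivializationAt (EuclideanSpace ℝ (Fin n)) (TangentSpace (𝓡 n)) x).symmL ℝ y v)) x := by
  rw [contMDiffAt_section]
  refine (contMDiffAt_const (c := v)).congr_of_eventuallyEq ?_
  filter_upwards [(trivializationAt (EuclideanSpace ℝ (Fin n))
    (TangentSpace (𝓡 n)) x).open_baseSet.mem_nhds
    (FiberBundle.mem_baseSet_trivializationAt' x)] with y hy
  have := (trivializationAt (EuclideanSpace ℝ (Fin n)) (TangentSpace (𝓡 n)) x).apply_mk_symm hy v
  simp only [Trivialization.symmL_apply _ hy]
  exact congrArg Prod.snd this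

/-- Each coefficient is `g(α(ρ) X, Y)` for smooth local frame fields `X, Y`, because the inverse of
the trivialization at `x` is the derivative of the inverse chart. -/
lemma contDiffAt_slabForm (g : ContMDiffRiemannianMetric (𝓡 n) ∞ (EuclideanSpace ℝ (Fin n))
      (fun x : M => TangentSpace (𝓡 n) x)) (hε : 0 < ε)
    {α : ℝ → ∀ x : M, TangentSpace (𝓡 n) x →L[ℝ] TangentSpace (𝓡 n) x}
    (hα : IsAdmissibleFamily ε g.inner α) (x : M) :
    ContDiffAt ℝ ∞ (slabForm g.inner α x) (0, extChartAt (𝓡 n) x x) := by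
  refine contDiffAt_of_bilin_apply fun v w => ?_
  have hX : ∀ v, ContMDiffAt (𝓘(ℝ, ℝ).prod (𝓡 n)) ((𝓡 n).prod 𝓘(ℝ, EuclideanSpace ℝ (Fin n))) ∞
      (fun q : ℝ × M => TotalSpace.mk' (EuclideanSpace ℝ (Fin n))
        (E := TangentSpace (𝓡 n) (M := M)) q.2
        ((trivializationAt (EuclideanSpace ℝ (Fin n)) (TangentSpace (𝓡 n)) x).symmL ℝ q.2 v))
      ((0 : ℝ), x) := fun v =>
    ContMDiffAt.comp (x := ((0 : ℝ), x)) (g := fun y => TotalSpace.mk' (EuclideanSpace ℝ (Fin n))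
      (E := TangentSpace (𝓡 n) (M := M)) y
        ((trivializationAt (EuclideanSpace ℝ (Fin n)) (TangentSpace (𝓡 n)) x).symmL ℝ y v))
      (f := Prod.snd) (contMDiffAt_localFrame x v) contMDiffAt_snd
  -- The family is smooth only on the slab `|ρ| < ε`, which is a neighbourhood of the points with `ρ
  -- = 0`.
  have h0 : Set.Ioo (-ε) ε ×ˢ (Set.univ : Set M) ∈ 𝓝 ((0 : ℝ), x) :=
    prod_mem_nhds (Ioo_mem_nhds (neg_lt_zero.2 hε) hε) Filter.univ_mem
  have hA := (hα.smooth.contMDiffAt h0).clm_bundle_apply (hX v)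
  have hg : ContMDiffAt (𝓘(ℝ, ℝ).prod (𝓡 n)) ((𝓡 n).prod
      𝓘(ℝ, EuclideanSpace ℝ (Fin n) →L[ℝ] EuclideanSpace ℝ (Fin n) →L[ℝ] ℝ)) ∞
      (fun q : ℝ × M => TotalSpace.mk'
        (EuclideanSpace ℝ (Fin n) →L[ℝ] EuclideanSpace ℝ (Fin n) →L[ℝ] ℝ)
        (E := fun x : M => TangentSpace (𝓡 n) x →L[ℝ] TangentSpace (𝓡 n) x →L[ℝ] ℝ)
        q.2 (g.inner q.2)) ((0 : ℝ), x) :=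
    ContMDiffAt.comp (x := ((0 : ℝ), x)) (g := fun y => TotalSpace.mk'
        (EuclideanSpace ℝ (Fin n) →L[ℝ] EuclideanSpace ℝ (Fin n) →L[ℝ] ℝ)
        (E := fun x : M => TangentSpace (𝓡 n) x →L[ℝ] TangentSpace (𝓡 n) x →L[ℝ] ℝ)
        y (g.inner y)) (f := Prod.snd) g.contMDiff.contMDiffAt contMDiffAt_snd
  have hf : ContMDiffAt (𝓘(ℝ, ℝ).prod (𝓡 n)) ((𝓡 n).prod 𝓘(ℝ, ℝ)) ∞
      (fun q : ℝ × M => TotalSpace.mk' ℝ (E := Bundle.Trivial M ℝ) q.2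
        (g.inner q.2 (α q.1 q.2 ((trivializationAt (EuclideanSpace ℝ (Fin n))
          (TangentSpace (𝓡 n)) x).symmL ℝ q.2 v))
          ((trivializationAt (EuclideanSpace ℝ (Fin n))
          (TangentSpace (𝓡 n)) x).symmL ℝ q.2 w))) ((0 : ℝ), x) :=
    ContMDiffAt.clm_bundle_apply₂ (F₁ := EuclideanSpace ℝ (Fin n))
      (F₂ := EuclideanSpace ℝ (Fin n)) hg hA (hX w)
  have hf2 := ((contMDiffAt_totalSpace.1 hf).2 : ContMDiffAt _ _ _ (fun q : ℝ × M => 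
        (g.inner q.2 (α q.1 q.2 ((trivializationAt (EuclideanSpace ℝ (Fin n))
          (TangentSpace (𝓡 n)) x).symmL ℝ q.2 v))
          ((trivializationAt (EuclideanSpace ℝ (Fin n))
          (TangentSpace (𝓡 n)) x).symmL ℝ q.2 w))) _)
  have h3 := (contMDiffAt_iff.1 hf2).2
  have hr : Set.range (𝓘(ℝ, ℝ).prod (𝓡 n)) = Set.univ := by simp
  rw [hr, contDiffWithinAt_univ] at h3
  refine h3.congr_of_eventuallyEq ?_
  have ht : ∀ᶠ q : ℝ × EuclideanSpace ℝ (Fin n) in 𝓝 (0, extChartAt (𝓡 n) x x),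
      q.2 ∈ (extChartAt (𝓡 n) x).target :=
    continuous_snd.continuousAt.preimage_mem_nhds (extChartAt_target_mem_nhds (I := 𝓡 n) x)
  filter_upwards [ht] with q hq
  have hs : (extChartAt (𝓡 n) x).symm q.2 ∈ (chartAt (EuclideanSpace ℝ (Fin n)) x).source := by
    rw [← extChartAt_source (𝓡 n)]
    exact (extChartAt (𝓡 n) x).map_target hq
  have h4 := TangentBundle.symmL_trivializationAt (𝕜 := ℝ) (I := 𝓡 n) hs
  rw [(extChartAt (𝓡 n) x).right_inv hq, (𝓡 n).range_eq_univ, mfderivWithin_univ] at h4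
  rw [slabForm_apply, ← h4]
  rfl

lemma contDiffAt_coordMetric (g : ContMDiffRiemannianMetric (𝓡 n) ∞ (EuclideanSpace ℝ (Fin n))
      (fun x : M => TangentSpace (𝓡 n) x)) (hε : 0 < ε)
    {α : ℝ → ∀ x : M, TangentSpace (𝓡 n) x →L[ℝ] TangentSpace (𝓡 n) x}
    (hα : IsAdmissibleFamily ε g.inner α) (x : M) :
    ContDiffAt ℝ ∞ (coordMetric g.inner x) (extChartAt (𝓡 n) x x) := by
  have h : coordMetric g.inner x = fun y => slabForm g.inner α x (0, y) :=
    funext fun y => (slabForm_zero g.inner hα x y).symm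
  rw [h]
  exact (contDiffAt_slabForm g hε hα x).comp (extChartAt (𝓡 n) x x)
    (contDiffAt_const.prodMk contDiffAt_id)

end Smoothness

/-! ### The gradient in coordinates and its smoothness. -/

section Gradient

variable {n : ℕ} {M : Type*} [TopologicalSpace M] [ChartedSpace (EuclideanSpace ℝ (Fin n)) M]
  [IsManifold (𝓡 n) ∞ M]
  (g : ContMDiffRiemannianMetric (𝓡 n) ∞ (EuclideanSpace ℝ (Fin n))
      (fun x : M => TangentSpace (𝓡 n) x))

lemma isInvertible_riemannian (x : M) : (modelForm g.inner x).IsInvertible := by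
  refine isInvertible_of_nondegenerate _ fun v hv => ?_
  by_contra hne
  exact (g.pos x v hne).ne' (hv v)

lemma riemannian_grad_apply (u : M → ℝ) (x : M) (v : TangentSpace (𝓡 n) x) :
    g.inner x (grad g.inner u x) v = mvfderiv (𝓡 n) u x v := by
  have h := (isInvertible_riemannian g x).self_apply_inverse
    (mvfderiv (𝓡 n) u x : TangentSpace (𝓡 n) x →L[ℝ] ℝ)
  exact DFunLike.congr_fun h v

omit [IsManifold (𝓡 n) ∞ M] in
lemma contDiffAt_comp_extChartAt_symm {u : M → ℝ} (hu : ContMDiff (𝓡 n) 𝓘(ℝ, ℝ) ∞ u) (x : M) :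
    ContDiffAt ℝ ∞ (u ∘ (extChartAt (𝓡 n) x).symm) (extChartAt (𝓡 n) x x) := by
  have h := (contMDiffAt_iff.1 (hu x)).2
  rw [(𝓡 n).range_eq_univ, contDiffWithinAt_univ] at h
  exact h

/-- The coordinates of the gradient in a chart: raise the index of the differential. -/
lemma grad_fieldCoord {u : M → ℝ} (hu : ContMDiff (𝓡 n) 𝓘(ℝ, ℝ) ∞ u) {x z : M}
    (hz : z ∈ (extChartAt (𝓡 n) x).source) :
    (mfderiv (𝓡 n) 𝓘(ℝ, EuclideanSpace ℝ (Fin n)) (extChartAt (𝓡 n) x) z (grad g.inner u z) :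
      EuclideanSpace ℝ (Fin n)) =
    (coordMetric g.inner x (extChartAt (𝓡 n) x z)).inverse
      (fderiv ℝ (u ∘ (extChartAt (𝓡 n) x).symm) (extChartAt (𝓡 n) x z)) := by
  have hy := (extChartAt (𝓡 n) x).map_source hz
  set φ := extChartAt (𝓡 n) x with hφ
  have hinv1 := mfderiv_extChartAt_comp_mfderivWithin_extChartAt_symm' (I := 𝓡 n) hz
  have hinv2 := mfderivWithin_extChartAt_symm_comp_mfderiv_extChartAt' (I := 𝓡 n) hz
  rw [(𝓡 n).range_eq_univ, mfderivWithin_univ] at hinv1 hinv2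
  have hBI : (coordMetric g.inner x (φ z)).IsInvertible := by
    refine isInvertible_of_nondegenerate _ fun v hv => ?_
    by_contra hne
    -- The derivative of the inverse chart is injective, having the derivative of the chart as a
    -- left inverse; positivity of `g` then passes to the coordinate metric.
    have hv0 : mfderiv 𝓘(ℝ, EuclideanSpace ℝ (Fin n)) (𝓡 n) φ.symm (φ z) v ≠ 0 := fun h0 => by
      have h1 := DFunLike.congr_fun hinv1 v
      have h2 : mfderiv (𝓡 n) 𝓘(ℝ, EuclideanSpace ℝ (Fin n)) φ z
        (mfderiv 𝓘(ℝ, EuclideanSpace ℝ (Fin n)) (𝓡 n) φ.symm (φ z) v) = v := h1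
      rw [h0] at h2
      exact hne (h2.symm.trans (map_zero _))
    exact (g.pos _ _ hv0).ne' (hv v)
  have hB : coordMetric g.inner x (φ z)
      (mfderiv (𝓡 n) 𝓘(ℝ, EuclideanSpace ℝ (Fin n)) φ z (grad g.inner u z)) =
      fderiv ℝ (u ∘ φ.symm) (φ z) := by
    ext w
    have hcomp := mfderiv_comp (φ z) (g := u) (f := φ.symm)
      (hu.contMDiffAt.mdifferentiableAt (by simp)) (mdifferentiableAt_extChartAt_symm (I := 𝓡 n) hy)
    rw [mfderiv_eq_fderiv] at hcomp
    rw [hcomp]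
    have h1 := DFunLike.congr_fun hinv2 (grad g.inner u z)
    have h2 : mfderiv 𝓘(ℝ, EuclideanSpace ℝ (Fin n)) (𝓡 n) φ.symm (φ z)
      (mfderiv (𝓡 n) 𝓘(ℝ, EuclideanSpace ℝ (Fin n)) φ z (grad g.inner u z)) = grad g.inner u z :=
        h1
    have h3 : φ.symm (φ z) = z := φ.left_inv hz
    have h4 := riemannian_grad_apply g u (φ.symm (φ z))
      (mfderiv 𝓘(ℝ, EuclideanSpace ℝ (Fin n)) (𝓡 n) φ.symm (φ z) w)
    have h5 : (show EuclideanSpace ℝ (Fin n) from grad g.inner u z) =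
        (show EuclideanSpace ℝ (Fin n) from grad g.inner u (φ.symm (φ z))) := by rw [h3]
    exact (congrArg (fun t => modelForm g.inner (φ.symm (φ z)) t
      (mfderiv 𝓘(ℝ, EuclideanSpace ℝ (Fin n)) (𝓡 n) φ.symm (φ z) w)) (h2.trans h5)).trans h4
  rw [← hB]
  exact (hBI.inverse_apply_self _).symm

/-- Inversion of operators is smooth at an invertible one, so raising the index of `du` by the
coordinate metric preserves smoothness. The family `α` is present because smoothness of the
coordinate metric is read off from `slabForm` at `ρ = 0`. -/
lemma contMDiff_grad {u : M → ℝ} (hu : ContMDiff (𝓡 n) 𝓘(ℝ, ℝ) ∞ u)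
    {ε : ℝ} (hε : 0 < ε) {α : ℝ → ∀ x : M, TangentSpace (𝓡 n) x →L[ℝ] TangentSpace (𝓡 n) x}
    (hα : IsAdmissibleFamily ε g.inner α) :
    ContMDiff (𝓡 n) (𝓡 n).tangent ∞
      (fun x => (⟨x, grad g.inner u x⟩ : TangentBundle (𝓡 n) M)) := by
  intro x
  refine (contMDiffAt_section x).2 ?_
  have hI : (coordMetric g.inner x (extChartAt (𝓡 n) x x)).IsInvertible := by
    rw [coordMetric_self]
    exact isInvertible_riemannian g x
  have h1 : ContDiffAt ℝ ∞ (fun y => (coordMetric g.inner x y).inverse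
      (fderiv ℝ (u ∘ (extChartAt (𝓡 n) x).symm) y)) (extChartAt (𝓡 n) x x) :=
    (hI.contDiffAt_map_inverse.comp _ (contDiffAt_coordMetric g hε hα x)).clm_apply
      ((contDiffAt_comp_extChartAt_symm hu x).fderiv_right (by simp))
  have h2 := h1.contMDiffAt.comp x (contMDiffAt_extChartAt (I := 𝓡 n) (n := ∞) (x := x))
  refine h2.congr_of_eventuallyEq ?_
  filter_upwards [extChartAt_source_mem_nhds (I := 𝓡 n) x] with z hz
  refine Eq.trans ?_ (grad_fieldCoord g hu hz)
  rw [extChartAt_source] at hz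
  have := TangentBundle.continuousLinearMapAt_trivializationAt (𝕜 := ℝ) (I := 𝓡 n) hz
  rw [← this]
  exact (congrFun (Trivialization.coe_linearMapAt_of_mem (R := ℝ)
    (trivializationAt (EuclideanSpace ℝ (Fin n)) (TangentSpace (𝓡 n)) x) hz)
    (grad g.inner u z)).symm

end Gradient

/-! ### Differential calculus in the variables `t`, `ρ` and a coordinate of `M`. -/

section SlabCalculus

variable {F W : Type*} [NormedAddCommGroup F] [NormedSpace ℝ F]
  [NormedAddCommGroup W] [NormedSpace ℝ W]

lemma hasDerivAt_slab {Q : ℝ × F → W} {y : F} (hQ : DifferentiableAt ℝ Q (0, y)) :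
    HasDerivAt (fun ρ : ℝ => Q (ρ, y)) (fderiv ℝ Q (0, y) (1, 0)) 0 := by
  have h1 : HasDerivAt (fun ρ : ℝ => (ρ, y)) (1, 0) 0 :=
    (hasDerivAt_id (0 : ℝ)).prodMk (hasDerivAt_const (0 : ℝ) y)
  exact HasFDerivAt.comp_hasDerivAt (0 : ℝ) hQ.hasFDerivAt h1

/-- Separates the `ρ` derivative, the source of `α̇(0)`, from the derivative within the slice `ρ =
0`, the source of the Christoffel symbols of `g`. -/
lemma fderiv_slab {Q : ℝ × F → W} {y : F} (hQ : DifferentiableAt ℝ Q (0, y)) (b : ℝ) (d : F) :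
    fderiv ℝ Q (0, y) (b, d) =
      b • fderiv ℝ Q (0, y) (1, 0) + fderiv ℝ (fun y => Q (0, y)) y d := by
  have h1 : HasFDerivAt (fun y : F => ((0 : ℝ), y)) (ContinuousLinearMap.inr ℝ ℝ F) y :=
    (ContinuousLinearMap.inr ℝ ℝ F).hasFDerivAt
  have h2 : HasFDerivAt (fun y => Q (0, y)) _ y := hQ.hasFDerivAt.comp y h1
  rw [h2.fderiv]
  have h4 : ((b, d) : ℝ × F) = b • ((1 : ℝ), 0) + (0, d) := by simp
  rw [h4, map_add, map_smul]
  simp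

/-- The value of the ambient metric on `X, Y` in coordinates, where `q` is the value of the forms
`g(α(ρ) ·, ·)` on the components tangent to `M`. -/
def ambientCoord (q : ℝ × F → ℝ) (X Y y : (ℝ × ℝ) × F) : ℝ :=
  (y.1.2 * X.1.1 + y.1.1 * X.1.2) * Y.1.1 + X.1.1 * (y.1.2 * Y.1.1 + y.1.1 * Y.1.2)
    + y.1.1 ^ 2 * q (y.1.2, y.2)

lemma contDiffAt_ambientCoord {q : ℝ × F → ℝ} {X Y y : (ℝ × ℝ) × F}
    (hq : ContDiffAt ℝ ∞ q (y.1.2, y.2)) : ContDiffAt ℝ ∞ (ambientCoord q X Y) y := by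
  have hq' : ContDiffAt ℝ ∞ (fun y : (ℝ × ℝ) × F => q (y.1.2, y.2)) y :=
    ContDiffAt.comp y hq (by fun_prop)
  unfold ambientCoord
  fun_prop

lemma fderiv_ambientCoord {q : ℝ × F → ℝ} {y : (ℝ × ℝ) × F}
    (hq : DifferentiableAt ℝ q (y.1.2, y.2)) (V X Y : (ℝ × ℝ) × F) :
    fderiv ℝ (ambientCoord q X Y) y V =
      (V.1.2 * X.1.1 + V.1.1 * X.1.2) * Y.1.1 + X.1.1 * (V.1.2 * Y.1.1 + V.1.1 * Y.1.2)
        + 2 * y.1.1 * V.1.1 * q (y.1.2, y.2)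
        + y.1.1 ^ 2 * fderiv ℝ q (y.1.2, y.2) (V.1.2, V.2) := by
  have ht : HasFDerivAt (fun y : (ℝ × ℝ) × F => y.1.1)
      ((ContinuousLinearMap.fst ℝ ℝ ℝ).comp (ContinuousLinearMap.fst ℝ (ℝ × ℝ) F)) y :=
    ((ContinuousLinearMap.fst ℝ ℝ ℝ).comp (ContinuousLinearMap.fst ℝ (ℝ × ℝ) F)).hasFDerivAt
  have hr : HasFDerivAt (fun y : (ℝ × ℝ) × F => y.1.2)
      ((ContinuousLinearMap.snd ℝ ℝ ℝ).comp (ContinuousLinearMap.fst ℝ (ℝ × ℝ) F)) y :=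
    ((ContinuousLinearMap.snd ℝ ℝ ℝ).comp (ContinuousLinearMap.fst ℝ (ℝ × ℝ) F)).hasFDerivAt
  have hs : HasFDerivAt (fun y : (ℝ × ℝ) × F => y.2) (ContinuousLinearMap.snd ℝ (ℝ × ℝ) F) y :=
    (ContinuousLinearMap.snd ℝ (ℝ × ℝ) F).hasFDerivAt
  have hq' : HasFDerivAt (fun y : (ℝ × ℝ) × F => q (y.1.2, y.2)) _ y :=
    hq.hasFDerivAt.comp y (hr.prodMk hs)
  have h := ((((hr.mul_const X.1.1).add (ht.mul_const X.1.2)).mul_const Y.1.1).add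
    (((hr.mul_const Y.1.1).add (ht.mul_const Y.1.2)).const_mul X.1.1)).add ((ht.pow 2).mul hq')
  have h' : HasFDerivAt (ambientCoord q X Y) _ y := h
  rw [h'.fderiv]
  simp
  ring

end SlabCalculus

/-! ### First derivatives of the ambient metric along `ρ = 0`. -/

section AmbientDerivative

variable {n : ℕ} {M : Type*} [TopologicalSpace M] [ChartedSpace (EuclideanSpace ℝ (Fin n)) M]
  [IsManifold (𝓡 n) ∞ M]
  (g : ContMDiffRiemannianMetric (𝓡 n) ∞ (EuclideanSpace ℝ (Fin n))
      (fun x : M => TangentSpace (𝓡 n) x))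
  {ε : ℝ} {α : ℝ → ∀ x : M, TangentSpace (𝓡 n) x →L[ℝ] TangentSpace (𝓡 n) x}

lemma differentiableAt_slabForm_apply (hε : 0 < ε) (hα : IsAdmissibleFamily ε g.inner α) (x : M)
    (v : EuclideanSpace ℝ (Fin n)) :
    DifferentiableAt ℝ (fun q => slabForm g.inner α x q v) (0, extChartAt (𝓡 n) x x) :=
  ((contDiffAt_slabForm g hε hα x).clm_apply contDiffAt_const).differentiableAt (by simp)

/-- `alphaDot` differentiates a curve of vectors, `slabForm` a curve of forms. At the chart centre
they differ by lowering the index with the fixed isomorphism `g x`, which commutes with the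
derivative. -/
lemma riemannian_alphaDot (hε : 0 < ε) (hα : IsAdmissibleFamily ε g.inner α) (x : M)
    (v w : EuclideanSpace ℝ (Fin n)) :
    modelForm g.inner x (alphaDot α x v) w =
      fderiv ℝ (fun q => slabForm g.inner α x q v w) (0, extChartAt (𝓡 n) x x) (1, 0) := by
  have h2 := differentiableAt_slabForm_apply g hε hα x v
  have h3 := hasDerivAt_slab h2
  have h4 := ((modelForm g.inner x).inverse.hasFDerivAt).comp_hasDerivAt (0 : ℝ) h3
  have h5 : (((modelForm g.inner x).inverse : _ → EuclideanSpace ℝ (Fin n)) ∘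
      fun ρ : ℝ => slabForm g.inner α x (ρ, extChartAt (𝓡 n) x x) v) = fun ρ : ℝ => α ρ x v := by
    funext ρ
    rw [Function.comp_apply, slabForm_base g.inner α x ρ v]
    exact (isInvertible_riemannian g x).inverse_apply_self _
  have h6 : alphaDot α x v = (modelForm g.inner x).inverse
      (fderiv ℝ (fun q => slabForm g.inner α x q v) (0, extChartAt (𝓡 n) x x) (1, 0)) :=
    Eq.trans (congrArg (fun f => deriv f (0 : ℝ)) h5).symm h4.deriv
  rw [h6, (isInvertible_riemannian g x).self_apply_inverse,
    (h2.hasFDerivAt.clm_apply (hasFDerivAt_const w _)).fderiv]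
  simp

lemma fderiv_slabForm (hε : 0 < ε) (hα : IsAdmissibleFamily ε g.inner α) (x : M)
    (b : ℝ) (d v w : EuclideanSpace ℝ (Fin n)) :
    fderiv ℝ (fun q => slabForm g.inner α x q v w) (0, extChartAt (𝓡 n) x x) (b, d) =
      b * modelForm g.inner x (alphaDot α x v) w
        + fderiv ℝ (coordMetric g.inner x) (extChartAt (𝓡 n) x x) d v w := by
  have h2 : DifferentiableAt ℝ (fun q => slabForm g.inner α x q v w) (0, extChartAt (𝓡 n) x x) :=
    (differentiableAt_slabForm_apply g hε hα x v).clm_apply (differentiableAt_const w)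
  have h3 : (fun y => slabForm g.inner α x (0, y) v w) = fun y => coordMetric g.inner x y v w :=
    funext fun y => by rw [slabForm_zero g.inner hα x y]
  rw [fderiv_slab h2, riemannian_alphaDot g hε hα, h3,
    fderiv_bilin_apply ((contDiffAt_coordMetric g hε hα x).differentiableAt (by simp))]
  rfl

/-- The formula holds on the chart target; equality of germs suffices for first derivatives. -/
lemma coordMetric_ambient_eventuallyEq
    (p : ambientBase ε × M) (X Y : (ℝ × ℝ) × EuclideanSpace ℝ (Fin n)) :
    (fun y => coordMetric (ambientMetric g.inner α) p y X Y) =ᶠ[𝓝 (extChartAt (ambientModel n) p p)]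
      ambientCoord (fun q => slabForm g.inner α p.2 q X.2 Y.2) X Y := by
  filter_upwards [extChartAt_target_mem_nhds (I := ambientModel n) p] with y hy
  rw [coordMetric_apply]
  refine (ambientMetric_apply g.inner α _ _ _).trans ?_
  rw [mfderiv_extChartAt_symm_ambient p hy, mfderiv_extChartAt_symm_ambient p hy,
    extChartAt_ambient_symm_fst p hy]
  rfl

/-- The derivative of the ambient metric in coordinates, at a point with `ρ = 0`. -/
lemma fderiv_coordMetric_ambient (hε : 0 < ε) (hα : IsAdmissibleFamily ε g.inner α)
    (p : ambientBase ε × M) (hp : p.1.1.2 = 0) (V X Y : (ℝ × ℝ) × EuclideanSpace ℝ (Fin n)) :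
    fderiv ℝ (coordMetric (ambientMetric g.inner α) p) (extChartAt (ambientModel n) p p) V X Y =
      (V.1.2 * X.1.1 + V.1.1 * X.1.2) * Y.1.1 + X.1.1 * (V.1.2 * Y.1.1 + V.1.1 * Y.1.2)
        + 2 * p.1.1.1 * V.1.1 * modelForm g.inner p.2 X.2 Y.2
        + p.1.1.1 ^ 2 * (V.1.2 * modelForm g.inner p.2 (alphaDot α p.2 X.2) Y.2
          + fderiv ℝ (coordMetric g.inner p.2) (extChartAt (𝓡 n) p.2 p.2) V.2 X.2 Y.2) := by
  have hy : extChartAt (ambientModel n) p p = (p.1.1, extChartAt (𝓡 n) p.2 p.2) :=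
    extChartAt_ambient_apply p p
  have hQ := contDiffAt_slabForm g hε hα p.2
  rw [← hp] at hQ
  have hc : ∀ X Y, ContDiffAt ℝ ∞
      (ambientCoord (fun q => slabForm g.inner α p.2 q X.2 Y.2) X Y)
      (extChartAt (ambientModel n) p p) := fun X Y =>
    contDiffAt_ambientCoord (by
      rw [hy]
      exact (hQ.clm_apply contDiffAt_const).clm_apply contDiffAt_const)
  have hd : DifferentiableAt ℝ (coordMetric (ambientMetric g.inner α) p)
      (extChartAt (ambientModel n) p p) := by
    refine (contDiffAt_of_bilin_apply (k := ∞) fun X Y => ?_).differentiableAt (by simp)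
    exact (hc X Y).congr_of_eventuallyEq (coordMetric_ambient_eventuallyEq g p X Y)
  rw [fderiv_bilin_apply hd, (coordMetric_ambient_eventuallyEq g p X Y).fderiv_eq, hy,
    fderiv_ambientCoord (((hQ.clm_apply contDiffAt_const).clm_apply
      contDiffAt_const).differentiableAt (by simp))]
  simp only [hp]
  rw [fderiv_slabForm g hε hα, slabForm_zero g.inner hα, coordMetric_self]

end AmbientDerivative

/-! ### The immersion, its induced metric and the lightlike normal frame. -/

section Immersion

variable {n : ℕ} {M : Type*} [TopologicalSpace M] [ChartedSpace (EuclideanSpace ℝ (Fin n)) M]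
  {ε : ℝ} (hε : 0 < ε) {u : M → ℝ}

lemma contMDiff_scaleImmersion (hu : ContMDiff (𝓡 n) 𝓘(ℝ, ℝ) ∞ u) :
    ContMDiff (𝓡 n) (ambientModel n) ∞ (scaleImmersion hε u) := by
  refine ContMDiff.prodMk ((ContMDiff.subtypeVal_comp_iff _ _).1 ?_) contMDiff_id
  exact (Real.contDiff_exp.contMDiff.comp hu).prodMk_space contMDiff_const

/-- Needed for `c = 1`, in the differential of the immersion, and for `c = -2`, in the coefficients
of `η`. -/
lemma mvfderiv_exp_const_mul (hu : ContMDiff (𝓡 n) 𝓘(ℝ, ℝ) ∞ u) (c : ℝ) (x : M)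
    (v : TangentSpace (𝓡 n) x) :
    mvfderiv (𝓡 n) (fun y => Real.exp (c * u y)) x v =
      c * Real.exp (c * u x) * mvfderiv (𝓡 n) u x v := by
  have h1 : HasFDerivAt (fun s : ℝ => Real.exp (c * s))
      (ContinuousLinearMap.toSpanSingleton ℝ (Real.exp (c * u x) * (c * 1))) (u x) :=
    (((hasDerivAt_id (u x)).const_mul c).exp).hasFDerivAt
  have h2 := h1.hasMFDerivAt.comp x ((hu x).mdifferentiableAt (by simp)).hasMFDerivAt
  refine (DFunLike.congr_fun h2.mfderiv v).trans ?_
  show ContinuousLinearMap.toSpanSingleton ℝ (Real.exp (c * u x) * (c * 1))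
    (mvfderiv (𝓡 n) u x v) = _
  rw [ContinuousLinearMap.toSpanSingleton_apply, smul_eq_mul]
  ring

/-- The differential of `u` as a linear form on the model space. -/
def modelDiff (u : M → ℝ) (x : M) : EuclideanSpace ℝ (Fin n) →L[ℝ] ℝ := mvfderiv (𝓡 n) u x

lemma mfderiv_scaleImmersion (hu : ContMDiff (𝓡 n) 𝓘(ℝ, ℝ) ∞ u) (x : M)
    (v : EuclideanSpace ℝ (Fin n)) :
    (mfderiv (𝓡 n) (ambientModel n) (scaleImmersion hε u) x v :
      (ℝ × ℝ) × EuclideanSpace ℝ (Fin n)) =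
      ((Real.exp (u x) * modelDiff u x v, 0), v) := by
  have hd := (contMDiff_scaleImmersion hε hu x).mdifferentiableAt (by simp)
  have he : ContMDiff (𝓡 n) 𝓘(ℝ, ℝ × ℝ) ∞ (fun y => (Real.exp (u y), (0 : ℝ))) :=
    (Real.contDiff_exp.contMDiff.comp hu).prodMk_space contMDiff_const
  have hed := (he x).mdifferentiableAt (by simp)
  refine Prod.ext ((mfderiv_ambient_fst hd v).trans (Prod.ext ?_ ?_))
    ((mfderiv_ambient_snd hd v).trans ?_)
  · refine (mfderiv_prod_fst hed v).trans ?_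
    have := mvfderiv_exp_const_mul hu 1 x v
    simp only [one_mul] at this
    exact this
  · refine (mfderiv_prod_snd hed v).trans ?_
    show mfderiv (𝓡 n) 𝓘(ℝ, ℝ) (fun _ => (0 : ℝ)) x v = _
    rw [mfderiv_const]
    rfl
  · show mfderiv (𝓡 n) (𝓡 n) (fun y => y) x v = v
    exact DFunLike.congr_fun (mfderiv_id (I := 𝓡 n) (x := x)) v

variable [IsManifold (𝓡 n) ∞ M]

-- The chart of `B` at every point is the inclusion, so the coordinates of a field in the
-- trivialization are its plane components.
omit [IsManifold (𝓡 n) ∞ M] in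
lemma contMDiff_ambientBase_field (b : M → ambientBase ε) (hb : ContMDiff (𝓡 n) 𝓘(ℝ, ℝ × ℝ) ∞ b)
    {a : M → ℝ × ℝ} (ha : ContMDiff (𝓡 n) 𝓘(ℝ, ℝ × ℝ) ∞ a) :
    ContMDiff (𝓡 n) 𝓘(ℝ, ℝ × ℝ).tangent ∞
      (fun x => (⟨b x, a x⟩ : TangentBundle 𝓘(ℝ, ℝ × ℝ) (ambientBase ε))) := by
  intro x
  refine contMDiffAt_totalSpace.2 ⟨hb x, (ha x).congr_of_eventuallyEq ?_⟩
  refine Filter.Eventually.of_forall fun y => ?_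
  have hy : b y ∈ (chartAt (ℝ × ℝ) (b x)).source := by
    simp [TopologicalSpace.Opens.chartAt_eq, chartAt_self_eq]
  have h1 := TangentBundle.continuousLinearMapAt_trivializationAt (𝕜 := ℝ) (I := 𝓘(ℝ, ℝ × ℝ)) hy
  rw [extChartAt_ambientBase, mfderiv_ambientBase_val] at h1
  have h2 := congrFun (Trivialization.coe_linearMapAt_of_mem (R := ℝ)
    (trivializationAt (ℝ × ℝ) (TangentSpace 𝓘(ℝ, ℝ × ℝ)) (b x)) hy) (a y)
  exact h2.symm.trans (DFunLike.congr_fun h1 (a y))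

lemma contMDiff_ambientVec (hu : ContMDiff (𝓡 n) 𝓘(ℝ, ℝ) ∞ u) {a b : M → ℝ}
    (ha : ContMDiff (𝓡 n) 𝓘(ℝ, ℝ) ∞ a) (hb : ContMDiff (𝓡 n) 𝓘(ℝ, ℝ) ∞ b)
    {v : ∀ x : M, TangentSpace (𝓡 n) x}
    (hv : ContMDiff (𝓡 n) (𝓡 n).tangent ∞ (fun x => (⟨x, v x⟩ : TangentBundle (𝓡 n) M))) :
    ContMDiff (𝓡 n) (ambientModel n).tangent ∞
      (fun x => (⟨scaleImmersion hε u x, ambientVec (scaleImmersion hε u x) (a x) (b x) (v x)⟩ :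
        TangentBundle (ambientModel n) (ambientBase ε × M))) :=
  (contMDiff_equivTangentBundleProd_symm (I := 𝓘(ℝ, ℝ × ℝ)) (M := ambientBase ε) (I' := 𝓡 n)
    (M' := M)).comp ((contMDiff_ambientBase_field (fun x => (scaleImmersion hε u x).1)
      (contMDiff_fst.comp (contMDiff_scaleImmersion hε hu)) (ha.prodMk_space hb)).prodMk hv)

variable (g : ContMDiffRiemannianMetric (𝓡 n) ∞ (EuclideanSpace ℝ (Fin n))
      (fun x : M => TangentSpace (𝓡 n) x))
  {α : ℝ → ∀ x : M, TangentSpace (𝓡 n) x →L[ℝ] TangentSpace (𝓡 n) x}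

lemma contMDiff_xiField (hu : ContMDiff (𝓡 n) 𝓘(ℝ, ℝ) ∞ u) :
    ContMDiff (𝓡 n) (ambientModel n).tangent ∞
      (fun x => (⟨scaleImmersion hε u x, xiField hε u x⟩ :
        TangentBundle (ambientModel n) (ambientBase ε × M))) :=
  contMDiff_ambientVec hε hu (Real.contDiff_exp.contMDiff.comp hu) contMDiff_const
    (contMDiff_zeroSection ℝ (TangentSpace (𝓡 n) : M → Type _))

lemma contMDiff_etaField (hα : IsAdmissibleFamily ε g.inner α)
    (hu : ContMDiff (𝓡 n) 𝓘(ℝ, ℝ) ∞ u) :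
    ContMDiff (𝓡 n) (ambientModel n).tangent ∞
      (fun x => (⟨scaleImmersion hε u x, etaField g.inner hε u x⟩ :
        TangentBundle (ambientModel n) (ambientBase ε × M))) := by
  have hgrad := contMDiff_grad g hu hε hα
  have hnorm : ContMDiff (𝓡 n) 𝓘(ℝ, ℝ) ∞
      (fun x => g.inner x (grad g.inner u x) (grad g.inner u x)) := fun x => by
    have h := ContMDiffAt.clm_bundle_apply₂ (F₁ := EuclideanSpace ℝ (Fin n))
      (F₂ := EuclideanSpace ℝ (Fin n)) (E₃ := Bundle.Trivial M ℝ) (F₃ := ℝ)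
      g.contMDiff.contMDiffAt (hgrad x) (hgrad x)
    exact (contMDiffAt_totalSpace.1 h).2
  have hexp : ∀ c : ℝ, ContMDiff (𝓡 n) 𝓘(ℝ, ℝ) ∞ (fun x => Real.exp (c * u x)) := fun c =>
    (Real.contDiff_exp.contMDiff.comp (contMDiff_const.mul hu))
  refine contMDiff_ambientVec hε hu ?_ (hexp (-2)).neg ((hexp (-2)).smul_section hgrad)
  have h := (hexp (-1)).mul (hnorm.mul (contMDiff_const (c := (2 : ℝ)⁻¹)))
  refine h.congr fun x => ?_
  simp [div_eq_mul_inv]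

lemma ambientMetric_scaleImmersion_apply (hα : IsAdmissibleFamily ε g.inner α) (x : M)
    (X Y : (ℝ × ℝ) × EuclideanSpace ℝ (Fin n)) :
    modelForm (ambientMetric g.inner α) (scaleImmersion hε u x) X Y =
      Real.exp (u x) * X.1.2 * Y.1.1 + Real.exp (u x) * X.1.1 * Y.1.2
        + Real.exp (u x) ^ 2 * modelForm g.inner x X.2 Y.2 := by
  have h : modelForm (ambientMetric g.inner α) (scaleImmersion hε u x) X Y =
      (0 * X.1.1 + Real.exp (u x) * X.1.2) * Y.1.1 + X.1.1 * (0 * Y.1.1 + Real.exp (u x) * Y.1.2)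
        + Real.exp (u x) ^ 2 * g.inner x (α 0 x X.2) Y.2 := rfl
  have h0 : g.inner x (α 0 x X.2) Y.2 = modelForm g.inner x X.2 Y.2 := by
    rw [hα.at_zero]
    rfl
  rw [h, h0]
  ring

lemma isInvertible_ambientMetric (hα : IsAdmissibleFamily ε g.inner α) (x : M) :
    (modelForm (ambientMetric g.inner α) (scaleImmersion hε u x)).IsInvertible := by
  refine isInvertible_of_nondegenerate _ fun X hX => ?_
  have hexp := Real.exp_pos (u x)
  simp only [ambientMetric_scaleImmersion_apply hε g hα] at hX
  -- Pairing with `∂_t` isolates the `∂_ρ` component, pairing with `∂_ρ` the `∂_t` component, and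
  -- pairing with the part tangent to `M` gives its squared norm up to a positive factor.
  have h1 := hX ((1, 0), 0)
  have h2 := hX ((0, 1), 0)
  have h3 := hX ((0, 0), X.2)
  simp only [mul_zero, mul_one, add_zero, zero_add, map_zero, mul_eq_zero,
    hexp.ne', false_or, pow_eq_zero_iff, ne_eq, OfNat.ofNat_ne_zero, not_false_eq_true] at h1 h2 h3
  refine Prod.ext (Prod.ext h2 h1) ?_
  by_contra hne
  exact (g.pos x X.2 hne).ne' h3

/-- At `ρ = 0` the `B` block pairs `∂_t` only with `∂_ρ`. The image of `w` has no `∂_ρ` component,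
so the `∂_t` component of `X` drops out. -/
lemma metric_mfderiv_scaleImmersion (hα : IsAdmissibleFamily ε g.inner α)
    (hu : ContMDiff (𝓡 n) 𝓘(ℝ, ℝ) ∞ u) (x : M) (X : (ℝ × ℝ) × EuclideanSpace ℝ (Fin n))
    (w : EuclideanSpace ℝ (Fin n)) :
    modelForm (ambientMetric g.inner α) (scaleImmersion hε u x) X
      (mfderiv (𝓡 n) (ambientModel n) (scaleImmersion hε u) x w) =
      Real.exp (u x) ^ 2 * (X.1.2 * modelDiff u x w + modelForm g.inner x X.2 w) := by
  refine (congrArg (modelForm (ambientMetric g.inner α) (scaleImmersion hε u x) X)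
    (mfderiv_scaleImmersion hε hu x w)).trans ?_
  rw [ambientMetric_scaleImmersion_apply hε g hα]
  ring

lemma inducedMetric_scaleImmersion (hα : IsAdmissibleFamily ε g.inner α)
    (hu : ContMDiff (𝓡 n) 𝓘(ℝ, ℝ) ∞ u) (x : M) :
    inducedMetric (J := 𝓡 n) (ambientMetric g.inner α) (scaleImmersion hε u) x
        = Real.exp (2 * u x) • g.inner x := by
  ext v w
  refine (metric_mfderiv_scaleImmersion hε g hα hu x
    (mfderiv (𝓡 n) (ambientModel n) (scaleImmersion hε u) x v) w).trans ?_
  have h2 := congrArg (fun X : (ℝ × ℝ) × EuclideanSpace ℝ (Fin n) =>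
    Real.exp (u x) ^ 2 * (X.1.2 * modelDiff u x w + modelForm g.inner x X.2 w))
    (mfderiv_scaleImmersion hε hu x v)
  refine h2.trans ?_
  simp only [zero_mul, zero_add, ← Real.exp_nat_mul]
  rfl

/-- The gradient as a vector of the model space. -/
def modelGrad (u : M → ℝ) (x : M) : EuclideanSpace ℝ (Fin n) := grad g.inner u x

lemma modelForm_modelGrad (u : M → ℝ) (x : M) (v : EuclideanSpace ℝ (Fin n)) :
    modelForm g.inner x (modelGrad g u x) v = modelDiff u x v :=
  riemannian_grad_apply g u x v

omit [IsManifold (𝓡 n) ∞ M] in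
lemma xiField_eq (x : M) : (xiField hε u x : (ℝ × ℝ) × EuclideanSpace ℝ (Fin n)) =
    ((Real.exp (u x), 0), 0) := rfl

lemma etaField_eq (x : M) : (etaField g.inner hε u x : (ℝ × ℝ) × EuclideanSpace ℝ (Fin n)) =
    ((Real.exp (-u x) * (modelForm g.inner x (modelGrad g u x) (modelGrad g u x) / 2),
      -Real.exp (-2 * u x)), Real.exp (-2 * u x) • modelGrad g u x) := rfl

lemma exp_neg_two_mul_eq (s : ℝ) : Real.exp (-2 * s) = (Real.exp s ^ 2)⁻¹ := by
  rw [← Real.exp_nat_mul, ← Real.exp_neg]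
  congr 1
  push_cast
  ring

lemma xiField_normal (hα : IsAdmissibleFamily ε g.inner α)
    (hu : ContMDiff (𝓡 n) 𝓘(ℝ, ℝ) ∞ u) (x : M) (v : EuclideanSpace ℝ (Fin n)) :
    modelForm (ambientMetric g.inner α) (scaleImmersion hε u x) (xiField hε u x)
      (mfderiv (𝓡 n) (ambientModel n) (scaleImmersion hε u) x v) = 0 := by
  refine (metric_mfderiv_scaleImmersion hε g hα hu x (xiField hε u x) v).trans ?_
  rw [xiField_eq, map_zero, zero_mul, zero_apply, add_zero, mul_zero]

/-- The `∂_ρ` coefficient contributes `-e^{-2u} du(w)`, and the gradient part cancels it. -/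
lemma etaField_normal (hα : IsAdmissibleFamily ε g.inner α)
    (hu : ContMDiff (𝓡 n) 𝓘(ℝ, ℝ) ∞ u) (x : M) (v : EuclideanSpace ℝ (Fin n)) :
    modelForm (ambientMetric g.inner α) (scaleImmersion hε u x) (etaField g.inner hε u x)
      (mfderiv (𝓡 n) (ambientModel n) (scaleImmersion hε u) x v) = 0 := by
  refine (metric_mfderiv_scaleImmersion hε g hα hu x (etaField g.inner hε u x) v).trans ?_
  rw [etaField_eq, map_smul, smul_apply, modelForm_modelGrad g u x v, smul_eq_mul, neg_mul,
    neg_add_cancel, mul_zero]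

/-- The fields `ξ` and `η` form a global lightlike normal frame. -/
lemma isLightlikeNormalFrame_xi_eta (hα : IsAdmissibleFamily ε g.inner α)
    (hu : ContMDiff (𝓡 n) 𝓘(ℝ, ℝ) ∞ u) :
    IsLightlikeNormalFrame (𝓡 n) (ambientMetric g.inner α) (scaleImmersion hε u)
      (xiField hε u) (etaField g.inner hε u) where
  smooth_left := contMDiff_xiField hε hu
  smooth_right := contMDiff_etaField hε g hα hu
  normal_left x v := xiField_normal hε g hα hu x v
  normal_right x v := etaField_normal hε g hα hu x v
  null_left x := by
    refine (ambientMetric_scaleImmersion_apply hε g hα x (xiField hε u x)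
      (xiField hε u x)).trans ?_
    rw [xiField_eq]
    simp
  null_right x := by
    refine (ambientMetric_scaleImmersion_apply hε g hα x (etaField g.inner hε u x)
      (etaField g.inner hε u x)).trans ?_
    rw [etaField_eq]
    simp only [map_smul, smul_apply, smul_eq_mul, exp_neg_two_mul_eq, Real.exp_neg]
    have := (Real.exp_pos (u x)).ne'
    field_simp
    ring
  pairing x := by
    refine (ambientMetric_scaleImmersion_apply hε g hα x (xiField hε u x)
      (etaField g.inner hε u x)).trans ?_
    rw [etaField_eq, xiField_eq]
    simp only [map_zero, zero_apply, exp_neg_two_mul_eq]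
    have := (Real.exp_pos (u x)).ne'
    field_simp
    simp

end Immersion

/-! ### Covariant derivatives paired with a vector. -/

section CovariantDerivative

variable {E : Type*} [NormedAddCommGroup E] [NormedSpace ℝ E]
  {H : Type*} [TopologicalSpace H] {I : ModelWithCorners ℝ E H}
  {M : Type*} [TopologicalSpace M] [ChartedSpace H M]
  {E' : Type*} [NormedAddCommGroup E'] [NormedSpace ℝ E']
  {H' : Type*} [TopologicalSpace H'] {J : ModelWithCorners ℝ E' H'}
  {N : Type*} [TopologicalSpace N] [ChartedSpace H' N]

/-- The coordinates of a field `ξ` along `Ψ` in the preferred chart at `Ψ x`. -/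
def fieldCoord (Ψ : N → M) (ξ : ∀ x : N, TangentSpace I (Ψ x)) (x x' : N) : E :=
  mfderiv I 𝓘(ℝ, E) (extChartAt I (Ψ x)) (Ψ x') (ξ x')

lemma christoffelFirst_smul (B : E → E →L[ℝ] E →L[ℝ] ℝ) (y v w u : E) (s : ℝ) :
    christoffelFirst B y v (s • w) u = s * christoffelFirst B y v w u := by
  have h1 : fderiv ℝ B y v (s • w) u = s * fderiv ℝ B y v w u := by
    rw [(fderiv ℝ B y v).map_smul]; rfl
  have h2 : fderiv ℝ B y (s • w) v u = s * fderiv ℝ B y w v u := by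
    rw [(fderiv ℝ B y).map_smul]; rfl
  have h3 : fderiv ℝ B y u v (s • w) = s * fderiv ℝ B y u v w := by
    rw [(fderiv ℝ B y u v).map_smul]; rfl
  rw [christoffelFirst_apply, christoffelFirst_apply, h1, h2, h3]
  ring

lemma christoffelFirst_zero (B : E → E →L[ℝ] E →L[ℝ] ℝ) (y v u : E) :
    christoffelFirst B y v 0 u = 0 := by
  simpa using christoffelFirst_smul B y v 0 u 0

/-- Pairing with the metric undoes the raising of the index in the Christoffel symbols and leaves
the first-kind symbols. -/
lemma metric_covDerivAlong [I.Boundaryless] [IsManifold I 1 M]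
    (G : ∀ x : M, TangentSpace I x →L[ℝ] TangentSpace I x →L[ℝ] ℝ)
    (Ψ : N → M) (ξ : ∀ x : N, TangentSpace I (Ψ x)) (x : N) (v : TangentSpace J x)
    (hG : (modelForm G (Ψ x)).IsInvertible) (w : E) :
    modelForm G (Ψ x) (covDerivAlong (J := J) G Ψ ξ x v) w =
      modelForm G (Ψ x) (mfderiv J 𝓘(ℝ, E) (fieldCoord Ψ ξ x) x v) w +
        christoffelFirst (coordMetric G (Ψ x)) (extChartAt I (Ψ x) (Ψ x))
          (mfderiv J I Ψ x v) (ξ x) w := by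
  let d : E := mfderiv J 𝓘(ℝ, E) (fieldCoord Ψ ξ x) x v
  let c : E := christoffel G (Ψ x) (mfderiv J I Ψ x v) (ξ x)
  have h : covDerivAlong (J := J) G Ψ ξ x v = d + c := rfl
  exact (congrArg (fun z => modelForm G (Ψ x) z w) h).trans
    ((congrArg (fun f : E →L[ℝ] ℝ => f w) (map_add (modelForm G (Ψ x)) _ _)).trans
      (congrArg (modelForm G (Ψ x) (mfderiv J 𝓘(ℝ, E) (fieldCoord Ψ ξ x) x v) w + ·)
        (metric_christoffel G (Ψ x) hG (mfderiv J I Ψ x v) (ξ x) w)))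

end CovariantDerivative

/-! ### The Weingarten endomorphisms of the two normal fields. -/

section Weingarten

variable {n : ℕ} {M : Type*} [TopologicalSpace M] [ChartedSpace (EuclideanSpace ℝ (Fin n)) M]
  [IsManifold (𝓡 n) ∞ M] {ε : ℝ} (hε : 0 < ε) {u : M → ℝ}
  (g : ContMDiffRiemannianMetric (𝓡 n) ∞ (EuclideanSpace ℝ (Fin n))
      (fun x : M => TangentSpace (𝓡 n) x))
  {α : ℝ → ∀ x : M, TangentSpace (𝓡 n) x →L[ℝ] TangentSpace (𝓡 n) x}

/-- The Weingarten endomorphism is determined by the tangential products of the derivative. -/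
lemma weingarten_scaleImmersion_eq (hα : IsAdmissibleFamily ε g.inner α)
    (hu : ContMDiff (𝓡 n) 𝓘(ℝ, ℝ) ∞ u)
    (ξ : ∀ x : M, TangentSpace (ambientModel n) (scaleImmersion hε u x)) (x : M)
    (v : TangentSpace (𝓡 n) x) (A : EuclideanSpace ℝ (Fin n))
    (h : ∀ w : EuclideanSpace ℝ (Fin n),
      modelForm (ambientMetric g.inner α) (scaleImmersion hε u x)
        (covDerivAlong (J := 𝓡 n) (ambientMetric g.inner α) (scaleImmersion hε u) ξ x v)
        (mfderiv (𝓡 n) (ambientModel n) (scaleImmersion hε u) x w) =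
      -(Real.exp (u x) ^ 2 * modelForm g.inner x A w)) :
    weingarten (ambientMetric g.inner α) (scaleImmersion hε u) ξ x v = A := by
  have hI : (Real.exp (2 * u x) • modelForm g.inner x).IsInvertible := by
    refine isInvertible_of_nondegenerate _ fun w hw => ?_
    by_contra hne
    have h1 := hw w
    rw [smul_apply, smul_apply, smul_eq_mul] at h1
    exact (mul_pos (Real.exp_pos _) (g.pos x w hne)).ne' h1
  let f : EuclideanSpace ℝ (Fin n) →L[ℝ] ℝ := (ambientMetric g.inner α (scaleImmersion hε u x)
    (covDerivAlong (J := 𝓡 n) (ambientMetric g.inner α) (scaleImmersion hε u) ξ x v)).comp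
      (mfderiv (𝓡 n) (ambientModel n) (scaleImmersion hε u) x)
  have hf : f = (Real.exp (2 * u x) • modelForm g.inner x) (-A) := by
    ext w
    refine (h w).trans ?_
    rw [smul_apply, map_neg, ← Real.exp_nat_mul]
    exact (mul_neg _ _).symm
  have hw : (weingarten (ambientMetric g.inner α) (scaleImmersion hε u) ξ x v :
      EuclideanSpace ℝ (Fin n)) = -(Real.exp (2 * u x) • modelForm g.inner x).inverse f := by
    unfold weingarten tangentPart
    rw [inducedMetric_scaleImmersion hε g hα hu]
    rfl
  refine hw.trans ?_
  rw [hf, hI.inverse_apply_self, neg_neg]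

lemma fieldCoord_scaleImmersion_eventuallyEq
    (ξ : ∀ x : M, TangentSpace (ambientModel n) (scaleImmersion hε u x)) (x : M) :
    fieldCoord (scaleImmersion hε u) ξ x =ᶠ[𝓝 x] fun x' =>
      ((show (ℝ × ℝ) × EuclideanSpace ℝ (Fin n) from ξ x').1,
        mfderiv (𝓡 n) 𝓘(ℝ, EuclideanSpace ℝ (Fin n)) (extChartAt (𝓡 n) x) x'
          (show (ℝ × ℝ) × EuclideanSpace ℝ (Fin n) from ξ x').2) := by
  filter_upwards [(chartAt (EuclideanSpace ℝ (Fin n)) x).open_source.mem_nhds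
    (mem_chart_source _ x)] with x' hx'
  refine mfderiv_extChartAt_ambient (scaleImmersion hε u x) (scaleImmersion hε u x') ⟨?_, hx'⟩ _
  simp [TopologicalSpace.Opens.chartAt_eq, chartAt_self_eq]

/-- The derivative of `α` at `0` as a map of the model space. -/
def modelAlphaDot (α : ℝ → ∀ x : M, TangentSpace (𝓡 n) x →L[ℝ] TangentSpace (𝓡 n) x) (x : M)
    (v : EuclideanSpace ℝ (Fin n)) : EuclideanSpace ℝ (Fin n) := alphaDot α x v

/-- The covariant derivative of the gradient as a map of the model space. -/
def modelHess (u : M → ℝ) (x : M) (v : EuclideanSpace ℝ (Fin n)) : EuclideanSpace ℝ (Fin n) :=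
  leviCivita g.inner (grad g.inner u) x v

/-- The tangential products of the covariant derivative of a field along `Ψ^u`, in terms of its
components and of the components of the derivative of its coordinates. -/
lemma metric_covDerivAlong_scaleImmersion (hα : IsAdmissibleFamily ε g.inner α)
    (hu : ContMDiff (𝓡 n) 𝓘(ℝ, ℝ) ∞ u)
    (ξ : ∀ x : M, TangentSpace (ambientModel n) (scaleImmersion hε u x)) (x : M)
    (z d : (ℝ × ℝ) × EuclideanSpace ℝ (Fin n)) (hξ : ξ x = z) (v w : EuclideanSpace ℝ (Fin n))
    (hd : mfderiv (𝓡 n) 𝓘(ℝ, (ℝ × ℝ) × EuclideanSpace ℝ (Fin n))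
      (fieldCoord (scaleImmersion hε u) ξ x) x v = d) :
    modelForm (ambientMetric g.inner α) (scaleImmersion hε u x)
        (covDerivAlong (J := 𝓡 n) (ambientMetric g.inner α) (scaleImmersion hε u) ξ x v)
        (mfderiv (𝓡 n) (ambientModel n) (scaleImmersion hε u) x w) =
      Real.exp (u x) ^ 2 * (d.1.2 * modelDiff u x w + modelForm g.inner x d.2 w
        + christoffelFirst (coordMetric g.inner x) (extChartAt (𝓡 n) x x) v z.2 w
        + modelDiff u x v * modelForm g.inner x z.2 w - modelDiff u x w * modelForm g.inner x v z.2
        + z.1.2 * modelDiff u x v * modelDiff u x w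
        + z.1.1 * (Real.exp (u x))⁻¹ * modelForm g.inner x v w
        + z.1.2 / 2 * modelForm g.inner x (modelAlphaDot α x v) w) := by
  refine (metric_covDerivAlong _ _ _ _ _ (isInvertible_ambientMetric hε g hα x) _).trans ?_
  have hT : ∀ v : EuclideanSpace ℝ (Fin n),
      (mfderiv (𝓡 n) (ambientModel n) (scaleImmersion hε u) x v :
        (ℝ × ℝ) × EuclideanSpace ℝ (Fin n)) = ((Real.exp (u x) * modelDiff u x v, 0), v) :=
    mfderiv_scaleImmersion hε hu x
  have h1 : modelForm (ambientMetric g.inner α) (scaleImmersion hε u x)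
      (mfderiv (𝓡 n) 𝓘(ℝ, (ℝ × ℝ) × EuclideanSpace ℝ (Fin n))
        (fieldCoord (scaleImmersion hε u) ξ x) x v)
      (mfderiv (𝓡 n) (ambientModel n) (scaleImmersion hε u) x w) =
        Real.exp (u x) ^ 2 * (d.1.2 * modelDiff u x w + modelForm g.inner x d.2 w) :=
    (metric_mfderiv_scaleImmersion hε g hα hu x _ w).trans (by rw [hd])
  have h2 : christoffelFirst (coordMetric (ambientMetric g.inner α) (scaleImmersion hε u x))
      (extChartAt (ambientModel n) (scaleImmersion hε u x) (scaleImmersion hε u x))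
      (mfderiv (𝓡 n) (ambientModel n) (scaleImmersion hε u) x v) (ξ x)
      (mfderiv (𝓡 n) (ambientModel n) (scaleImmersion hε u) x w) =
    christoffelFirst (coordMetric (ambientMetric g.inner α) (scaleImmersion hε u x))
      (extChartAt (ambientModel n) (scaleImmersion hε u x) (scaleImmersion hε u x))
      ((Real.exp (u x) * modelDiff u x v, 0), v) z ((Real.exp (u x) * modelDiff u x w, 0), w) := by
    rw [hT v, hT w, hξ]
  refine (congrArg₂ (· + ·) h1 h2).trans ?_
  -- The images of `v` and `w` have no `∂_ρ` component, so of the three derivatives in the Koszul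
  -- formula only the one along `z` produces `α̇(0)`.
  have h3 := fderiv_coordMetric_ambient g hε hα (scaleImmersion hε u x) rfl
  simp only [christoffelFirst_apply, h3]
  have ht : (scaleImmersion hε u x).1.1.1 = Real.exp (u x) := rfl
  have hx : (scaleImmersion hε u x).2 = x := rfl
  have ha : modelForm g.inner x (alphaDot α (scaleImmersion hε u x).2 v) w =
    modelForm g.inner x (modelAlphaDot α x v) w := rfl
  simp only [ht, hx, ha]
  have := (Real.exp_pos (u x)).ne'
  field_simp
  ring

lemma modelForm_symm (x : M) (v w : EuclideanSpace ℝ (Fin n)) :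
    modelForm g.inner x v w = modelForm g.inner x w v := g.symm x v w

lemma mdifferentiableAt_fieldCoord
    (ξ : ∀ x : M, TangentSpace (ambientModel n) (scaleImmersion hε u x))
    (h : ContMDiff (𝓡 n) (ambientModel n).tangent ∞
      (fun x => (⟨scaleImmersion hε u x, ξ x⟩ :
        TangentBundle (ambientModel n) (ambientBase ε × M)))) (x : M) :
    MDifferentiableAt (𝓡 n) 𝓘(ℝ, (ℝ × ℝ) × EuclideanSpace ℝ (Fin n))
      (fieldCoord (scaleImmersion hε u) ξ x) x :=
  (contMDiffAt_fieldCoord (h x)).mdifferentiableAt (by simp)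

-- Applied to projections `L`, this extracts components of the derivative of a coordinate field.
omit [IsManifold (𝓡 n) ∞ M] in
lemma clm_mfderiv_apply {F G : Type*} [NormedAddCommGroup F] [NormedSpace ℝ F]
    [NormedAddCommGroup G] [NormedSpace ℝ G] (L : F →L[ℝ] G) {f : M → F} {x : M}
    (hf : MDifferentiableAt (𝓡 n) 𝓘(ℝ, F) f x) (v : TangentSpace (𝓡 n) x) :
    L (mfderiv (𝓡 n) 𝓘(ℝ, F) f x v) = mfderiv (𝓡 n) 𝓘(ℝ, G) (fun y => L (f y)) x v := by
  have h1 := mfderiv_comp (I := 𝓡 n) x L.mdifferentiableAt hf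
  rw [ContinuousLinearMap.mfderiv_eq] at h1
  exact (DFunLike.congr_fun h1 v).symm

lemma weingarten_xiField (hα : IsAdmissibleFamily ε g.inner α)
    (hu : ContMDiff (𝓡 n) 𝓘(ℝ, ℝ) ∞ u) (x : M) (v : EuclideanSpace ℝ (Fin n)) :
    weingarten (J := 𝓡 n) (ambientMetric g.inner α) (scaleImmersion hε u)
      (xiField (n := n) (M := M) hε u) x v = -v := by
  have hc := fieldCoord_scaleImmersion_eventuallyEq hε (xiField (n := n) (M := M) hε u) x
  have hd := mdifferentiableAt_fieldCoord hε (xiField (n := n) (M := M) hε u)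
    (contMDiff_xiField hε hu) x
  refine weingarten_scaleImmersion_eq hε g hα hu (xiField (n := n) (M := M) hε u)
    x v (-v) fun w => ?_
  refine (metric_covDerivAlong_scaleImmersion hε g hα hu (xiField (n := n) (M := M) hε u)
    x _ _ (xiField_eq hε x)
    v w rfl).trans ?_
  have h1 : (mfderiv (𝓡 n) 𝓘(ℝ, (ℝ × ℝ) × EuclideanSpace ℝ (Fin n))
      (fieldCoord (scaleImmersion hε u) (xiField (n := n) (M := M) hε u) x) x v :
        (ℝ × ℝ) × EuclideanSpace ℝ (Fin n)).1.2 = 0 := by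
    refine (clm_mfderiv_apply ((ContinuousLinearMap.snd ℝ ℝ ℝ).comp
      (ContinuousLinearMap.fst ℝ (ℝ × ℝ) (EuclideanSpace ℝ (Fin n)))) hd v).trans ?_
    have he : (fun y => ((ContinuousLinearMap.snd ℝ ℝ ℝ).comp
      (ContinuousLinearMap.fst ℝ (ℝ × ℝ) (EuclideanSpace ℝ (Fin n))))
        (fieldCoord (scaleImmersion hε u) (xiField (n := n) (M := M) hε u) x y)) =ᶠ[𝓝 x]
          fun _ => (0 : ℝ) := by
      filter_upwards [hc] with y hy
      rw [hy]
      rfl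
    rw [he.mfderiv_eq, mfderiv_const]
    rfl
  have h2 : (mfderiv (𝓡 n) 𝓘(ℝ, (ℝ × ℝ) × EuclideanSpace ℝ (Fin n))
      (fieldCoord (scaleImmersion hε u) (xiField (n := n) (M := M) hε u) x) x v :
        (ℝ × ℝ) × EuclideanSpace ℝ (Fin n)).2 = 0 := by
    refine (clm_mfderiv_apply (ContinuousLinearMap.snd ℝ (ℝ × ℝ) (EuclideanSpace ℝ (Fin n)))
      hd v).trans ?_
    have he : (fun y => ContinuousLinearMap.snd ℝ (ℝ × ℝ) (EuclideanSpace ℝ (Fin n))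
        (fieldCoord (scaleImmersion hε u) (xiField (n := n) (M := M) hε u) x y)) =ᶠ[𝓝 x]
          fun _ => (0 : EuclideanSpace ℝ (Fin n)) := by
      filter_upwards [hc] with y hy
      rw [hy]
      exact map_zero (mfderiv (𝓡 n) 𝓘(ℝ, EuclideanSpace ℝ (Fin n)) (extChartAt (𝓡 n) x) y)
    rw [he.mfderiv_eq, mfderiv_const]
    rfl
  -- With the differentiated components and `z.2` zero, only the term `z.1.1 * (exp u)⁻¹ * g(v, w)`
  -- is left, and `z.1.1 = exp u`.
  have := (Real.exp_pos (u x)).ne'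
  rw [h1, h2]
  simp [christoffelFirst_zero, this]

/-- The derivative of the coordinates of the gradient. -/
lemma metric_leviCivita_grad (u : M → ℝ) (x : M) (v w : EuclideanSpace ℝ (Fin n)) :
    modelForm g.inner x (modelHess g u x v) w =
      modelForm g.inner x (mfderiv (𝓡 n) 𝓘(ℝ, EuclideanSpace ℝ (Fin n))
        (fieldCoord (fun y : M => y) (grad g.inner u) x) x v) w +
        christoffelFirst (coordMetric g.inner x) (extChartAt (𝓡 n) x x) v (modelGrad g u x) w := by
  refine (metric_covDerivAlong g.inner (fun y : M => y) (grad g.inner u) x v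
    (isInvertible_riemannian g x) w).trans ?_
  have h : (mfderiv (𝓡 n) (𝓡 n) (fun y : M => y) x v : EuclideanSpace ℝ (Fin n)) = v :=
    DFunLike.congr_fun (mfderiv_id (I := 𝓡 n) (x := x)) v
  rw [h]
  rfl

lemma weingarten_etaField (hα : IsAdmissibleFamily ε g.inner α)
    (hu : ContMDiff (𝓡 n) 𝓘(ℝ, ℝ) ∞ u) (x : M) (v : EuclideanSpace ℝ (Fin n)) :
    weingarten (J := 𝓡 n) (ambientMetric g.inner α) (scaleImmersion hε u)
        (etaField g.inner hε u) x v =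
      Real.exp (-2 * u x) • ((1 / 2 : ℝ) • (modelAlphaDot α x v
          - modelForm g.inner x (modelGrad g u x) (modelGrad g u x) • v)
        + modelForm g.inner x (modelGrad g u x) v • modelGrad g u x
        - modelHess g u x v) := by
  have hc := fieldCoord_scaleImmersion_eventuallyEq hε (etaField g.inner hε u) x
  have hd := mdifferentiableAt_fieldCoord hε (etaField g.inner hε u)
    (contMDiff_etaField hε g hα hu) x
  have hexp : MDifferentiableAt (𝓡 n) 𝓘(ℝ, ℝ) (fun y => Real.exp (-2 * u y)) x :=
    ((Real.contDiff_exp.contMDiff.comp (contMDiff_const.mul hu) :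
      ContMDiff (𝓡 n) 𝓘(ℝ, ℝ) ∞ (fun y => Real.exp (-2 * u y))) x).mdifferentiableAt (by simp)
  have hγ : MDifferentiableAt (𝓡 n) 𝓘(ℝ, EuclideanSpace ℝ (Fin n))
      (fieldCoord (fun y : M => y) (grad g.inner u) x) x :=
    (contMDiffAt_fieldCoord (Ψ := fun y : M => y)
      (contMDiff_grad g hu hε hα x)).mdifferentiableAt (by simp)
  refine weingarten_scaleImmersion_eq hε g hα hu (etaField g.inner hε u) x v _ fun w => ?_
  refine (metric_covDerivAlong_scaleImmersion hε g hα hu (etaField g.inner hε u) x _ _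
    (etaField_eq hε g x) v w rfl).trans ?_
  have h1 : (mfderiv (𝓡 n) 𝓘(ℝ, (ℝ × ℝ) × EuclideanSpace ℝ (Fin n))
      (fieldCoord (scaleImmersion hε u) (etaField g.inner hε u) x) x v :
        (ℝ × ℝ) × EuclideanSpace ℝ (Fin n)).1.2 = 2 * Real.exp (-2 * u x) * modelDiff u x v := by
    refine (clm_mfderiv_apply ((ContinuousLinearMap.snd ℝ ℝ ℝ).comp
      (ContinuousLinearMap.fst ℝ (ℝ × ℝ) (EuclideanSpace ℝ (Fin n)))) hd v).trans ?_
    have he : (fun y => ((ContinuousLinearMap.snd ℝ ℝ ℝ).comp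
      (ContinuousLinearMap.fst ℝ (ℝ × ℝ) (EuclideanSpace ℝ (Fin n))))
        (fieldCoord (scaleImmersion hε u) (etaField g.inner hε u) x y)) =ᶠ[𝓝 x]
          -fun y => Real.exp (-2 * u y) := by
      filter_upwards [hc] with y hy
      rw [hy]
      rfl
    rw [he.mfderiv_eq]
    have h3 := DFunLike.congr_fun (mvfderiv_neg (I := 𝓡 n) (x := x)
      (g := fun y => Real.exp (-2 * u y))) v
    refine h3.trans ?_
    refine (congrArg Neg.neg (mvfderiv_exp_const_mul hu (-2) x v)).trans ?_
    show -(-2 * Real.exp (-2 * u x) * modelDiff u x v) = _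
    ring
  let γ' : EuclideanSpace ℝ (Fin n) := mfderiv (𝓡 n) 𝓘(ℝ, EuclideanSpace ℝ (Fin n))
    (fieldCoord (fun y : M => y) (grad g.inner u) x) x v
  -- Product rule for `e^{-2u} ∇u`: the first summand will combine with the Christoffel symbols of
  -- `g`, the second comes from the conformal factor.
  have h2 : (mfderiv (𝓡 n) 𝓘(ℝ, (ℝ × ℝ) × EuclideanSpace ℝ (Fin n))
      (fieldCoord (scaleImmersion hε u) (etaField g.inner hε u) x) x v :
        (ℝ × ℝ) × EuclideanSpace ℝ (Fin n)).2 =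
      Real.exp (-2 * u x) • γ' +
        (-2 * Real.exp (-2 * u x) * modelDiff u x v) • modelGrad g u x := by
    refine (clm_mfderiv_apply (ContinuousLinearMap.snd ℝ (ℝ × ℝ) (EuclideanSpace ℝ (Fin n)))
      hd v).trans ?_
    have he : (fun y => ContinuousLinearMap.snd ℝ (ℝ × ℝ) (EuclideanSpace ℝ (Fin n))
        (fieldCoord (scaleImmersion hε u) (etaField g.inner hε u) x y)) =ᶠ[𝓝 x]
          (fun y => Real.exp (-2 * u y)) • fieldCoord (fun y : M => y) (grad g.inner u) x := by
      filter_upwards [hc] with y hy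
      rw [hy]
      exact map_smul (mfderiv (𝓡 n) 𝓘(ℝ, EuclideanSpace ℝ (Fin n)) (extChartAt (𝓡 n) x) y)
        (Real.exp (-2 * u y)) (grad g.inner u y)
    rw [he.mfderiv_eq]
    have h3 := DFunLike.congr_fun (mvfderiv_smul hexp hγ) v
    refine h3.trans ?_
    have h4 : fieldCoord (fun y : M => y) (grad g.inner u) x x = modelGrad g u x :=
      DFunLike.congr_fun (mfderiv_extChartAt_self (I := 𝓡 n) (x := x)) (grad g.inner u x)
    have h5 := mvfderiv_exp_const_mul hu (-2) x v
    exact congrArg (fun t : EuclideanSpace ℝ (Fin n) => Real.exp (-2 * u x) • γ' + t)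
      (congrArg₂ (fun (s : ℝ) (t : EuclideanSpace ℝ (Fin n)) => s • t) h5 h4)
  rw [h1, h2]
  have h6 : modelForm g.inner x (modelHess g u x v) w = modelForm g.inner x γ' w +
      christoffelFirst (coordMetric g.inner x) (extChartAt (𝓡 n) x x) v (modelGrad g u x) w :=
    metric_leviCivita_grad g u x v w
  -- In units of `e^{-2u}`, the terms in `du(v) du(w)` are `2` from the derivative of the `∂_ρ`
  -- coefficient, `-2` from the derivative of the factor `e^{-2u}`, and `1 - 1 - 1` from the ambient
  -- Christoffel symbols. The sum `-1` changes sign in the Weingarten formula.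
  simp only [map_add, map_sub, map_smul, add_apply, sub_apply, smul_apply, smul_eq_mul, h6,
    christoffelFirst_smul, modelForm_symm g x v, modelForm_modelGrad, exp_neg_two_mul_eq,
    Real.exp_neg]
  have := (Real.exp_pos (u x)).ne'
  field_simp
  ring

end Weingarten

end AmbientWeingarten

end

open AmbientWeingarten in
theorem proposition5p3 {n : ℕ} (hn : 2 ≤ n)
    {M : Type*} [TopologicalSpace M] [T2Space M] [SecondCountableTopology M]
    [ChartedSpace (EuclideanSpace ℝ (Fin n)) M] [IsManifold (𝓡 n) ∞ M]
    (g : Bundle.ContMDiffRiemannianMetric (𝓡 n) ∞ (EuclideanSpace ℝ (Fin n))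
      (fun x : M => TangentSpace (𝓡 n) x))
    {ε : ℝ} (hε : 0 < ε)
    (α : ℝ → ∀ x : M, TangentSpace (𝓡 n) x →L[ℝ] TangentSpace (𝓡 n) x)
    (hα : IsAdmissibleFamily ε g.inner α)
    (u : M → ℝ) (hu : ContMDiff (𝓡 n) 𝓘(ℝ, ℝ) ∞ u) :
    (∀ x : M, inducedMetric (J := 𝓡 n) (ambientMetric g.inner α) (scaleImmersion hε u) x
        = Real.exp (2 * u x) • g.inner x) ∧
    IsLightlikeNormalFrame (𝓡 n) (ambientMetric g.inner α) (scaleImmersion hε u)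
      (xiField hε u) (etaField g.inner hε u) ∧
    (∀ (x : M) (v : TangentSpace (𝓡 n) x),
      weingarten (ambientMetric g.inner α) (scaleImmersion hε u)
      (xiField (n := n) (M := M) hε u) x v = -v) ∧
    (∀ (x : M) (v : TangentSpace (𝓡 n) x),
      weingarten (ambientMetric g.inner α) (scaleImmersion hε u) (etaField g.inner hε u) x v
        = Real.exp (-2 * u x) •
          ((1 / 2 : ℝ) • (alphaDot α x v
              - g.inner x (grad g.inner u x) (grad g.inner u x) • v)
            + g.inner x (grad g.inner u x) v • grad g.inner u x
            - leviCivita g.inner (grad g.inner u) x v)) :=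
  ⟨inducedMetric_scaleImmersion hε g hα hu, isLightlikeNormalFrame_xi_eta hε g hα hu,
    weingarten_xiField hε g hα hu, weingarten_etaField hε g hα hu⟩
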